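/- Let $p$ be a prime number, $F$ an arbitrary field, and $\Omega$ a separable closure of $F$; all extensions of $F$ are taken inside $\Omega$. A degree-$p$ extension $E$ of $F$ is called solvable if it is separable and the Galois group over $F$ of its Galois closure is solvable. Let $K$ be the compositum of all cyclic extensions of $F$ of degree dividing $p-1$ (so $K$ is the maximal abelian extension of $F$ of exponent dividing $p-1$), and let $G=\mathrm{Gal}(K|F)$. Let $\omega\colon G\to\mathbf F_p^\times$ be the mod-$p$ cyclotomic character (giving the action of $G$ on the $p$-th roots of $1$, all of which lie in $K$) if $\mathrm{char}\,F\neq p$, and the trivial character if $\mathrm{char}\,F=p$. The group $G$ acts on the $\mathbf F_p$-space $V=K^\times/K^{\times p}$ if $\mathrm{char}\,F\neq p$, resp. $V=K/\wp(K)$ with $\wp(x)=x^p-x$ if $\mathrm{char}\,F=p$. For a character $\chi\colon G\to\mathbf F_p^\times$, let $V(\chi)$ be the subspace of all $v\in V$ such that $\sigma v=\chi(\sigma)v$ for every $\sigma\in G$, and let $F_\chi=K^{\mathrm{Ker}(\omega\chi^{-1})}$. Let $K'$ be the compositum of the fields $F_\chi$, where $\chi$ runs through the characters $G\to\mathbf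 F_p^\times$ with $V(\chi)\neq 0$. Then the compositum $C$ of all degree-$p$ solvable extensions of $F$ is the maximal abelian extension of $K'$ of exponent dividing $p$; that is, $C$ contains $K'$, is abelian of exponent dividing $p$ over $K'$, and contains every abelian extension of $K'$ of exponent dividing $p$ in $\Omega$. -/

import Mathlib

/-! Throughout, `p` is a prime number, `F` a field and `Ω` a separable closure of `F`; extensions of
`F` are intermediate fields of `Ω / F`. -/

namespace SolvableDegreeP

section Extensions

/-- `E / F` is a *solvable extension of degree `p`*: it has degree `p`, it is separable, and the
Galois group over `F` of its Galois closure (the normal closure of `E / F` inside `Ω`) is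
solvable. -/
def IsSolvableExt (p : ℕ) (F : Type*) {Ω : Type*} [Field F] [Field Ω] [Algebra F Ω]
    (E : IntermediateField F Ω) : Prop :=
  Module.finrank F E = p ∧ Algebra.IsSeparable F E ∧
    Group.IsSolvable Gal((IntermediateField.normalClosure F E Ω)/F)

/-- The compositum, inside `Ω`, of all solvable extensions of `F` of degree `p`. -/
def solvableCompositum (p : ℕ) (F Ω : Type*) [Field F] [Field Ω] [Algebra F Ω] :
    IntermediateField F Ω :=
  ⨆ (E : IntermediateField F Ω) (_ : IsSolvableExt p F E), E

/-- `L / F` is a (finite) cyclic extension of degree dividing `n`. -/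
def IsCyclicExtOfDegreeDvd (n : ℕ) (F : Type*) {Ω : Type*} [Field F] [Field Ω] [Algebra F Ω]
    (L : IntermediateField F Ω) : Prop :=
  FiniteDimensional F L ∧ IsGalois F L ∧ IsCyclic Gal(L/F) ∧ Module.finrank F L ∣ n

/-- `L / F` is an abelian extension (possibly infinite) of exponent dividing `n`. -/
def IsAbelianExtOfExponentDvd (n : ℕ) (F : Type*) {Ω : Type*} [Field F] [Field Ω] [Algebra F Ω]
    (L : IntermediateField F Ω) : Prop :=
  IsAbelianGalois F L ∧ Monoid.exponent Gal(L/F) ∣ n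

/-- The field `K`: the compositum of all cyclic extensions of `F` of degree dividing `p - 1`. -/
def fieldK (p : ℕ) (F Ω : Type*) [Field F] [Field Ω] [Algebra F Ω] : IntermediateField F Ω :=
  ⨆ (L : IntermediateField F Ω) (_ : IsCyclicExtOfDegreeDvd (p - 1) F L), L

end Extensions

section Modules

variable (p : ℕ) [Fact p.Prime]

/-- The group `Kˣ / (Kˣ) ^ p`, written additively. -/
def KummerQuot (K : Type*) [Field K] : Type _ :=
  Additive (Kˣ ⧸ (powMonoidHom p : Kˣ →* Kˣ).range)

instance (K : Type*) [Field K] : AddCommGroup (KummerQuot p K) :=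
  inferInstanceAs (AddCommGroup (Additive (Kˣ ⧸ (powMonoidHom p : Kˣ →* Kˣ).range)))

/-- The `𝔽_p`-vector space structure of `Kˣ / (Kˣ) ^ p`. -/
instance (K : Type*) [Field K] : Module (ZMod p) (KummerQuot p K) :=
  AddCommGroup.zmodModule (by
    rintro ⟨x⟩
    have h : (QuotientGroup.mk (x ^ p) : Kˣ ⧸ (powMonoidHom p : Kˣ →* Kˣ).range) = 1 :=
      (QuotientGroup.eq_one_iff (x ^ p)).2 (MonoidHom.mem_range.2 ⟨x, rfl⟩)
    exact congrArg Additive.ofMul h)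

/-- The natural action of `Gal(K/F)` on the `𝔽_p`-vector space `Kˣ / (Kˣ) ^ p`. -/
def kummerRep (F K : Type*) [Field F] [Field K] [Algebra F K] :
    Representation (ZMod p) Gal(K/F) (KummerQuot p K) where
  toFun σ := AddMonoidHom.toZModLinearMap (M := KummerQuot p K) (M₁ := KummerQuot p K) p
    (MonoidHom.toAdditive
      (QuotientGroup.map (powMonoidHom p : Kˣ →* Kˣ).range (powMonoidHom p : Kˣ →* Kˣ).range
        (Units.map (σ : K →* K)) (by
          intro y hy
          obtain ⟨x, rfl⟩ := MonoidHom.mem_range.1 hy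
          exact MonoidHom.mem_range.2 ⟨Units.map (σ : K →* K) x, by simp⟩)))
  map_one' := by
    ext ⟨x⟩
    exact congrArg (fun y : Kˣ ↦ (Additive.ofMul (QuotientGroup.mk y) :
      Additive (Kˣ ⧸ (powMonoidHom p : Kˣ →* Kˣ).range))) (Units.ext rfl)
  map_mul' σ τ := by
    ext ⟨x⟩
    exact congrArg (fun y : Kˣ ↦ (Additive.ofMul (QuotientGroup.mk y) :
      Additive (Kˣ ⧸ (powMonoidHom p : Kˣ →* Kˣ).range))) (Units.ext rfl)

/-- The additive map `℘ : K → K`, `x ↦ x ^ p - x`, in characteristic `p`. -/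
def artinSchreier (K : Type*) [Field K] [CharP K p] : K →+ K where
  toFun x := x ^ p - x
  map_zero' := by simp [(Fact.out : p.Prime).ne_zero]
  map_add' x y := by rw [add_pow_char]; ring

/-- The group `K / ℘(K)`. -/
def ArtinSchreierQuot (K : Type*) [Field K] [CharP K p] : Type _ :=
  K ⧸ (artinSchreier p K).range

instance (K : Type*) [Field K] [CharP K p] : AddCommGroup (ArtinSchreierQuot p K) :=
  inferInstanceAs (AddCommGroup (K ⧸ (artinSchreier p K).range))

/-- The `𝔽_p`-vector space structure of `K / ℘(K)`. -/
instance (K : Type*) [Field K] [CharP K p] : Module (ZMod p) (ArtinSchreierQuot p K) :=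
  AddCommGroup.zmodModule (by
    rintro ⟨x⟩
    have h : p • x = 0 := by rw [nsmul_eq_mul, CharP.cast_eq_zero, zero_mul]
    exact congrArg (fun y : K ↦ (QuotientAddGroup.mk y : K ⧸ (artinSchreier p K).range)) h)

/-- The natural action of `Gal(K/F)` on the `𝔽_p`-vector space `K / ℘(K)`. -/
def artinSchreierRep (F K : Type*) [Field F] [Field K] [Algebra F K] [CharP K p] :
    Representation (ZMod p) Gal(K/F) (ArtinSchreierQuot p K) where
  toFun σ := AddMonoidHom.toZModLinearMap (M := ArtinSchreierQuot p K)
    (M₁ := ArtinSchreierQuot p K) p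
    (QuotientAddGroup.map (artinSchreier p K).range (artinSchreier p K).range (σ : K →+ K) (by
      intro y hy
      obtain ⟨x, rfl⟩ := AddMonoidHom.mem_range.1 hy
      exact AddMonoidHom.mem_range.2 ⟨σ x, by simp [artinSchreier]⟩))
  map_one' := by
    ext ⟨x⟩
    rfl
  map_mul' σ τ := by
    ext ⟨x⟩
    rfl

/-- The `χ`-eigenspace `V(χ)` of a representation `ρ` of a group `G` on an `𝔽_p`-vector space `V`,
for a character `χ : G → 𝔽_pˣ`: all `v` with `σ v = χ(σ) v` for every `σ ∈ G`. -/
def charEigenspace {p : ℕ} {G V : Type*} [Group G] [AddCommGroup V] [Module (ZMod p) V]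
    (ρ : Representation (ZMod p) G V) (χ : G →* (ZMod p)ˣ) : Submodule (ZMod p) V where
  carrier := {v | ∀ σ : G, ρ σ v = (χ σ : ZMod p) • v}
  zero_mem' σ := by simp
  add_mem' ha hb σ := by simp [ha σ, hb σ]
  smul_mem' c v hv σ := by rw [map_smul, hv σ, smul_comm]

end Modules

section Characters

variable (p : ℕ) [Fact p.Prime] (F Ω : Type*) [Field F] [Field Ω] [Algebra F Ω]

/-- If the characteristic of `F` is not `p`, then `K` contains all `p`-th roots of unity. -/
theorem card_rootsOfUnity_fieldK [IsSepClosure F Ω] (h : (p : F) ≠ 0) :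
    Nat.card (rootsOfUnity p (fieldK p F Ω)) = p := by
  have hp : p.Prime := Fact.out
  have : IsSepClosed Ω := IsSepClosure.sep_closed F
  have : NeZero (p : Ω) := ⟨by
    intro h0
    apply h
    apply (algebraMap F Ω).injective
    simpa using h0⟩
  obtain ⟨ζ, hζ⟩ := HasEnoughRootsOfUnity.exists_primitiveRoot Ω p
  have : IsCyclotomicExtension {p} F (IntermediateField.adjoin F {ζ}) :=
    hζ.intermediateField_adjoin_isCyclotomicExtension F
  have : FiniteDimensional F (IntermediateField.adjoin F {ζ}) :=
    IsCyclotomicExtension.finite_of_singleton p F _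
  have : IsGalois F (IntermediateField.adjoin F {ζ}) :=
    IsCyclotomicExtension.isGalois {p} F _
  have hζ' := IsCyclotomicExtension.zeta_spec p F (IntermediateField.adjoin F {ζ})
  have inj := hζ'.autToPow_injective F
  have hL : IsCyclicExtOfDegreeDvd (p - 1) F (IntermediateField.adjoin F {ζ}) := by
    refine ⟨inferInstance, inferInstance, isCyclic_of_injective _ inj, ?_⟩
    rw [← IsGalois.card_aut_eq_finrank]
    have := Subgroup.card_dvd_of_injective _ inj
    rwa [Nat.card_eq_fintype_card (α := (ZMod p)ˣ), ZMod.card_units_eq_totient,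
      Nat.totient_prime hp] at this
  have hle : IntermediateField.adjoin F {ζ} ≤ fieldK p F Ω :=
    le_iSup₂_of_le (IntermediateField.adjoin F {ζ}) hL le_rfl
  have hmem : ζ ∈ fieldK p F Ω := hle (IntermediateField.mem_adjoin_simple_self F ζ)
  have hprim : IsPrimitiveRoot (⟨ζ, hmem⟩ : fieldK p F Ω) p :=
    IsPrimitiveRoot.of_map_of_injective (f := algebraMap (fieldK p F Ω) Ω) (by exact hζ)
      (algebraMap (fieldK p F Ω) Ω).injective
  exact hprim.card_rootsOfUnity

open Classical in
/-- The character `ω : Gal(K/F) → 𝔽_pˣ`: the mod `p` cyclotomic character, giving the action on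
the `p`-th roots of unity, if the characteristic of `F` is not `p`, and the trivial character if it
is `p`. -/
noncomputable def omega [IsSepClosure F Ω] : Gal((fieldK p F Ω)/F) →* (ZMod p)ˣ :=
  if h : (p : F) = 0 then 1
  else (modularCyclotomicCharacter (fieldK p F Ω) (card_rootsOfUnity_fieldK p F Ω h)).comp
    (MulSemiringAction.toRingAut Gal((fieldK p F Ω)/F) (fieldK p F Ω))

/-- The field `F_χ`, the subfield of `K` fixed by the kernel of `ω χ⁻¹`. -/
noncomputable def fieldChi [IsSepClosure F Ω] (χ : Gal((fieldK p F Ω)/F) →* (ZMod p)ˣ) :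
    IntermediateField F Ω :=
  IntermediateField.lift (IntermediateField.fixedField (omega p F Ω * χ⁻¹).ker)

/-- The `χ`-eigenspace of `Kˣ / (Kˣ) ^ p` (if the characteristic of `F` is not `p`), respectively
of `K / ℘(K)` (if the characteristic of `F` is `p`), is nontrivial. -/
def HasEigenvector (χ : Gal((fieldK p F Ω)/F) →* (ZMod p)ˣ) : Prop :=
  (¬ CharP F p ∧ charEigenspace (kummerRep p F (fieldK p F Ω)) χ ≠ ⊥) ∨
  (∃ _ : CharP F p,
    haveI : CharP (fieldK p F Ω) p := charP_of_injective_algebraMap' F p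
    charEigenspace (artinSchreierRep p F (fieldK p F Ω)) χ ≠ ⊥)

/-- The field `K'`, the compositum of the fields `F_χ` for those characters `χ` of `Gal(K/F)` whose
eigenspace is nontrivial. -/
noncomputable def fieldK' [IsSepClosure F Ω] : IntermediateField F Ω :=
  ⨆ (χ : Gal((fieldK p F Ω)/F) →* (ZMod p)ˣ) (_ : HasEigenvector p F Ω χ), fieldChi p F Ω χ

end Characters

end SolvableDegreeP

/-! Write Γ = Gal(Ω/F). By Galois's theorem, a transitive group of prime degree `p` is solvable only
if it is affine, so a solvable extension of degree `p` is the same as a pair (θ, c): a character θ :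
Γ → 𝔽_pˣ and a crossed homomorphism c : Γ → 𝔽_p for θ, both continuous, with c nonzero on ker θ. The
extension is the fixed field of the zeros of c (`isSolvableExt_iff`). Changing c by a coboundary
stays within such pairs, so Gal(Ω/C) consists of the g with θ(g) = 1 and c(g) = 0 for every pair
(`fixingSubgroup_solvableCompositum`).

The field K' is cut out by the characters θ alone (`mem_fixingSubgroup_fieldK'`). Kummer or
Artin–Schreier theory turns an eigenvector for χ into a homomorphism Gal(Ω/K) → 𝔽_p on which Γ acts
through θ = ωχ⁻¹ (`hasEigenvector_iff`). Since Γ/Gal(Ω/K) has exponent dividing p - 1, averaging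
extends this homomorphism to a crossed homomorphism on Γ (`exists_isAffine_of_isEquivariantOn`);
restriction goes the other way.

On Gal(Ω/K') every θ is trivial, so every c is a homomorphism to 𝔽_p, and C/K' is abelian of
exponent dividing `p`. Conversely, let g in Gal(Ω/K') move an element of an abelian extension of K'
of exponent dividing `p`. Some homomorphism Gal(Ω/K') → 𝔽_p is nonzero at g. As Γ/Gal(Ω/K') is
abelian of exponent dividing p - 1, this homomorphism splits into eigencomponents, and one that is
nonzero at g extends to a crossed homomorphism (`exists_isAffine_apply_ne_zero`). Hence g does not
fix C. -/

namespace SolvableDegreeP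

/-! ### Crossed homomorphisms to 𝔽_p: extension and eigencomponents. -/

section CrossedHoms

variable {p : ℕ} {Γ : Type*} [Group Γ]

/-- `c` is a crossed homomorphism from `Γ` to `𝔽_p` with `Γ` acting through `θ`. -/
def IsCrossedHom (θ : Γ →* (ZMod p)ˣ) (c : Γ → ZMod p) : Prop :=
  ∀ g h, c (g * h) = c g + (θ g : ZMod p) * c h

/-- `φ` is additive on the subgroup `N`. -/
def IsAddOn (N : Subgroup Γ) (φ : Γ → ZMod p) : Prop :=
  ∀ g ∈ N, ∀ h ∈ N, φ (g * h) = φ g + φ h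

/-- `φ` transforms under conjugation by `Γ` through the character `θ`. -/
def IsEquivariantOn (θ : Γ →* (ZMod p)ˣ) (N : Subgroup Γ) (φ : Γ → ZMod p) : Prop :=
  ∀ g, ∀ h ∈ N, φ (g * h * g⁻¹) = θ g * φ h

namespace IsCrossedHom

variable {θ : Γ →* (ZMod p)ˣ} {c : Γ → ZMod p}

theorem map_one (hc : IsCrossedHom θ c) : c 1 = 0 := by
  simpa using hc 1 1

theorem map_inv (hc : IsCrossedHom θ c) (g : Γ) : (θ g : ZMod p) * c g⁻¹ = -c g := by
  have h := hc g g⁻¹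
  rw [mul_inv_cancel, hc.map_one] at h
  linear_combination -h

/-- The subgroup of zeros of a crossed homomorphism. -/
def zeros (hc : IsCrossedHom θ c) : Subgroup Γ where
  carrier := {g | c g = 0}
  one_mem' := hc.map_one
  mul_mem' {a b} ha hb := by
    simp only [Set.mem_ofPred_eq] at *
    rw [hc, ha, hb]; simp
  inv_mem' {a} ha := by
    simp only [Set.mem_ofPred_eq] at *
    have h := hc.map_inv a
    rw [ha, neg_zero] at h
    exact (Units.mul_right_eq_zero _).1 h

theorem mem_zeros (hc : IsCrossedHom θ c) {g : Γ} : g ∈ hc.zeros ↔ c g = 0 := Iff.rfl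

theorem isAddOn (hc : IsCrossedHom θ c) {N : Subgroup Γ} (hN : ∀ g ∈ N, θ g = 1) :
    IsAddOn N c := by
  intro g hg h _
  rw [hc, hN g hg]; simp

theorem isEquivariantOn (hc : IsCrossedHom θ c) {N : Subgroup Γ} (hN : ∀ g ∈ N, θ g = 1) :
    IsEquivariantOn θ N c := by
  intro g h hh
  rw [hc, hc, _root_.map_mul, hN h hh, mul_one, hc.map_inv]
  ring

/-- Adding a coboundary. -/
theorem add_coboundary (hc : IsCrossedHom θ c) (t : ZMod p) :
    IsCrossedHom θ fun g ↦ c g + (1 - θ g) * t := by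
  intro g h
  simp only [hc g h, _root_.map_mul, Units.val_mul]
  ring

end IsCrossedHom

namespace IsAddOn

variable {N : Subgroup Γ} {φ : Γ → ZMod p}

theorem map_one (hφ : IsAddOn N φ) : φ 1 = 0 := by
  simpa using hφ 1 N.one_mem 1 N.one_mem

theorem map_inv (hφ : IsAddOn N φ) {g : Γ} (hg : g ∈ N) : φ g⁻¹ = -φ g := by
  have h := hφ g hg g⁻¹ (N.inv_mem hg)
  rw [mul_inv_cancel, hφ.map_one] at h
  linear_combination -h

theorem map_pow (hφ : IsAddOn N φ) {g : Γ} (hg : g ∈ N) (n : ℕ) : φ (g ^ n) = n * φ g := by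
  induction n with
  | zero => simpa using hφ.map_one
  | succ n ih =>
    rw [pow_succ, hφ _ (N.pow_mem hg n) _ hg, ih]
    push_cast; ring

theorem map_conj (hφ : IsAddOn N φ) {g h : Γ} (hg : g ∈ N) (hh : h ∈ N) :
    φ (g * h * g⁻¹) = φ h := by
  rw [hφ _ (N.mul_mem hg hh) _ (N.inv_mem hg), hφ _ hg _ hh, hφ.map_inv hg]; ring

theorem mono (hφ : IsAddOn N φ) {M : Subgroup Γ} (h : M ≤ N) : IsAddOn M φ :=
  fun g hg k hk ↦ hφ g (h hg) k (h hk)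

end IsAddOn

/-- An equivariant homomorphism on a subgroup of finite index prime to `p` extends to a crossed
homomorphism. -/
theorem exists_isCrossedHom_of_index [Fact p.Prime] {N : Subgroup Γ} [N.FiniteIndex]
    (hN : ((N.index : ℕ) : ZMod p) ≠ 0) {θ : Γ →* (ZMod p)ˣ} (hθ : ∀ g ∈ N, θ g = 1)
    {φ : Γ → ZMod p} (hφ : IsAddOn N φ) (heq : IsEquivariantOn θ N φ) (hn : N.Normal) :
    ∃ c : Γ → ZMod p, IsCrossedHom θ c ∧ ∀ g ∈ N, c g = φ g := by
  classical
  let _ : Fintype (Γ ⧸ N) := Fintype.ofFinite _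
  have hcard : ((Fintype.card (Γ ⧸ N) : ℕ) : ZMod p) ≠ 0 := by
    rwa [← Nat.card_eq_fintype_card, ← Subgroup.index_eq_card]
  let s : Γ ⧸ N → Γ := fun x ↦ x.out
  have hs : ∀ x, (s x : Γ ⧸ N) = x := fun x ↦ QuotientGroup.out_eq' x
  have hmem : ∀ (g : Γ) (x : Γ ⧸ N), (s (g • x))⁻¹ * g * s x ∈ N := by
    intro g x
    rw [mul_assoc, ← QuotientGroup.eq, hs]
    nth_rewrite 1 [← hs x]
    rfl
  have hθs : ∀ (g : Γ) (x : Γ ⧸ N), θ (s (g • x)) = θ g * θ (s x) := by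
    intro g x
    have h := hθ _ (hmem g x)
    rw [map_mul, map_mul, map_inv, mul_assoc] at h
    rw [inv_mul_eq_one] at h
    exact h
  -- This is corestriction. If φ came from a crossed homomorphism c, each term would be c(g) + θ(g)
  -- c(s x) - c(s(g x)), so the sum would be [Γ : N] c(g) up to a coboundary.
  let d : Γ → ZMod p := fun g ↦ ∑ x : Γ ⧸ N, (θ (s (g • x)) : ZMod p) * φ ((s (g • x))⁻¹ * g * s x)
  have hd : ∀ g h, d (g * h) = d g + θ g * d h := by
    intro g h
    have h1 : d g = ∑ x : Γ ⧸ N, (θ (s (g • h • x)) : ZMod p) *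
        φ ((s (g • h • x))⁻¹ * g * s (h • x)) :=
      (Fintype.sum_equiv (MulAction.toPerm h) _ _ fun x ↦ rfl).symm
    rw [h1, Finset.mul_sum, ← Finset.sum_add_distrib]
    refine Finset.sum_congr rfl fun x _ ↦ ?_
    have h2 : (s ((g * h) • x))⁻¹ * (g * h) * s x =
        ((s (g • h • x))⁻¹ * g * s (h • x)) * ((s (h • x))⁻¹ * h * s x) := by
      rw [mul_smul]; group
    rw [h2, hφ _ (hmem _ _) _ (hmem _ _), mul_smul, hθs g (h • x)]
    push_cast; ring
  refine ⟨fun g ↦ (Fintype.card (Γ ⧸ N) : ZMod p)⁻¹ * d g, ?_, ?_⟩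
  · intro g h
    simp only [hd]; ring
  · intro g hg
    -- An element of N fixes every coset, and by equivariance the factor θ cancels the conjugation,
    -- so all terms agree.
    have h1 : d g = ∑ _x : Γ ⧸ N, φ g := by
      refine Finset.sum_congr rfl fun x _ ↦ ?_
      have h2 : g • x = x := by
        nth_rewrite 1 [← hs x]
        rw [MulAction.Quotient.smul_coe]
        nth_rewrite 2 [← hs x]
        rw [eq_comm, QuotientGroup.eq, smul_eq_mul, ← mul_assoc]
        simpa using hn.conj_mem g hg (s x)⁻¹
      rw [h2]
      have := heq (s x)⁻¹ g hg
      rw [inv_inv] at this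
      rw [this, map_inv, ← mul_assoc, Units.mul_inv, one_mul]
    simp only [h1, Finset.sum_const, Finset.card_univ, nsmul_eq_mul]
    rw [← mul_assoc, inv_mul_cancel₀ hcard, one_mul]

/-- A homomorphism on `P` vanishing on `P ⊓ U` extends to `P ⊔ U` by zero on `U`. -/
theorem exists_extend_sup {P U : Subgroup Γ} (hP : P.Normal) (hU : U.Normal) {φ : Γ → ZMod p}
    (hφ : IsAddOn P φ) (h0 : ∀ g ∈ P, g ∈ U → φ g = 0) :
    ∃ ψ : Γ → ZMod p, IsAddOn (P ⊔ U) ψ ∧ (∀ g ∈ P, ψ g = φ g) ∧ (∀ g ∈ U, ψ g = 0) ∧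
      ∀ θ : Γ →* (ZMod p)ˣ, IsEquivariantOn θ P φ → IsEquivariantOn θ (P ⊔ U) ψ := by
  classical
  have hdec : ∀ g ∈ P ⊔ U, ∃ a ∈ P, ∃ b ∈ U, a * b = g :=
    fun g hg ↦ Subgroup.mem_sup_of_normal_right.1 hg
  let ψ : Γ → ZMod p := fun g ↦ if hg : g ∈ P ⊔ U then φ (hdec g hg).choose else 0
  -- Independence of the decomposition: two choices of the P-part differ by an element of P ⊓ U,
  -- where φ vanishes.
  have key : ∀ a ∈ P, ∀ b ∈ U, ψ (a * b) = φ a := by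
    intro a ha b hb
    have hg : a * b ∈ P ⊔ U := Subgroup.mul_mem_sup ha hb
    have e : ψ (a * b) = φ (hdec _ hg).choose := dif_pos hg
    rw [e]
    obtain ⟨h1, b', h2, h3⟩ := (hdec _ hg).choose_spec
    set a' := (hdec _ hg).choose
    have h4 : a⁻¹ * a' = b * b'⁻¹ := by
      rw [inv_mul_eq_iff_eq_mul, ← mul_assoc, eq_mul_inv_iff_mul_eq, h3]
    have h5 := h0 _ (P.mul_mem (P.inv_mem ha) h1) (h4 ▸ U.mul_mem hb (U.inv_mem h2))
    rw [hφ _ (P.inv_mem ha) _ h1, hφ.map_inv ha] at h5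
    linear_combination h5
  refine ⟨ψ, ?_, ?_, ?_, ?_⟩
  · intro g hg h hh
    obtain ⟨a, ha, b, hb, rfl⟩ := hdec g hg
    obtain ⟨a', ha', b', hb', rfl⟩ := hdec h hh
    have e : a * b * (a' * b') = (a * a') * ((a'⁻¹ * b * a') * b') := by group
    rw [e, key _ ha _ hb, key _ ha' _ hb', key _ (P.mul_mem ha ha') _
      (U.mul_mem (by simpa using hU.conj_mem b hb a'⁻¹) hb'), hφ _ ha _ ha']
  · intro g hg
    simpa using key g hg 1 U.one_mem
  · intro g hg
    simpa [hφ.map_one] using key 1 P.one_mem g hg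
  · intro θ hθ g h hh
    obtain ⟨a, ha, b, hb, rfl⟩ := hdec h hh
    have e : g * (a * b) * g⁻¹ = (g * a * g⁻¹) * (g * b * g⁻¹) := by group
    rw [e, key _ (hP.conj_mem a ha g) _ (hU.conj_mem b hb g), key _ ha _ hb, hθ g a ha]

/-- A homomorphism on `N`, where `Γ / N` is finite abelian of exponent dividing `p - 1`, is a
combination of equivariant ones. -/
theorem exists_isEquivariantOn_ne_zero [Fact p.Prime] {N : Subgroup Γ} [N.FiniteIndex]
    (hn : N.Normal) (hcomm : ∀ g h : Γ, g * h * g⁻¹ * h⁻¹ ∈ N) (hexp : ∀ g : Γ, g ^ (p - 1) ∈ N)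
    {ψ : Γ → ZMod p} (hψ : IsAddOn N ψ) {σ : Γ} (hσ : σ ∈ N) (hne : ψ σ ≠ 0) :
    ∃ (θ : Γ →* (ZMod p)ˣ) (φ : Γ → ZMod p), (∀ g ∈ N, θ g = 1) ∧ IsAddOn N φ ∧
      IsEquivariantOn θ N φ ∧ φ σ ≠ 0 ∧
      ∀ U : Subgroup Γ, U.Normal → (∀ g ∈ U, ψ g = 0) → ∀ g ∈ U, φ g = 0 := by
  classical
  let _ : Fintype (Γ ⧸ N) := Fintype.ofFinite _
  let _ : CommGroup (Γ ⧸ N) :=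
    { (inferInstance : Group (Γ ⧸ N)) with
      mul_comm := by
        rintro ⟨x⟩ ⟨y⟩
        refine QuotientGroup.eq.2 ?_
        have := hcomm y⁻¹ x⁻¹
        simpa [mul_assoc] using this }
  have hQexp : ∀ x : Γ ⧸ N, x ^ (p - 1) = 1 := by
    rintro ⟨x⟩
    exact (QuotientGroup.eq_one_iff (x ^ (p - 1))).2 (hexp x)
  let s : Γ ⧸ N → Γ := fun x ↦ x.out
  have hs : ∀ x, (s x : Γ ⧸ N) = x := fun x ↦ QuotientGroup.out_eq' x
  let C : Γ → Γ ⧸ N → ZMod p := fun τ x ↦ ψ ((s x)⁻¹ * τ * s x)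
  have hconj : ∀ g, ∀ τ ∈ N, g⁻¹ * τ * g ∈ N := fun g τ hτ ↦ by simpa using hn.conj_mem τ hτ g⁻¹
  have hC : ∀ τ ∈ N, ∀ g : Γ, C τ (g : Γ ⧸ N) = ψ (g⁻¹ * τ * g) := by
    intro τ hτ g
    have hm : (s (g : Γ ⧸ N))⁻¹ * g ∈ N := QuotientGroup.eq.1 (hs g)
    have h1 := hψ.map_conj (N := N) hm (hconj g τ hτ)
    rw [← h1]
    exact congrArg ψ (by group)
  -- The χ-component of ψ under conjugation, without the normalising factor.
  let Φ : (Γ ⧸ N →* (ZMod p)ˣ) → Γ → ZMod p := fun χ τ ↦ ∑ x, (χ x : ZMod p) * C τ x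
  have hfin : Finite (Γ ⧸ N →* (ZMod p)ˣ) := DFunLike.finite _
  let _ : Fintype (Γ ⧸ N →* (ZMod p)ˣ) := Fintype.ofFinite _
  -- Orthogonality of characters leaves only the trivial coset; 𝔽_p contains enough roots of unity
  -- because the exponent of Γ/N divides p - 1.
  have hsum : ∑ χ, Φ χ σ = (Fintype.card (Γ ⧸ N →* (ZMod p)ˣ) : ZMod p) * ψ σ := by
    have hp1 : HasEnoughRootsOfUnity (ZMod p) (Monoid.exponent (Γ ⧸ N)) := by
      have : NeZero (p - 1) := ⟨by have := (Fact.out : p.Prime).two_le; omega⟩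
      exact HasEnoughRootsOfUnity.of_dvd (ZMod p) (Monoid.exponent_dvd_of_forall_pow_eq_one hQexp)
    have hz : ∀ x : Γ ⧸ N, x ≠ 1 → ∑ χ : Γ ⧸ N →* (ZMod p)ˣ, (χ x : ZMod p) = 0 := by
      intro x hx
      obtain ⟨χ₀, hχ₀⟩ := CommGroup.exists_apply_ne_one_of_hasEnoughRootsOfUnity
        (Γ ⧸ N) (ZMod p) hx
      have h1 : ∑ χ : Γ ⧸ N →* (ZMod p)ˣ, (χ x : ZMod p) =
          (χ₀ x : ZMod p) * ∑ χ : Γ ⧸ N →* (ZMod p)ˣ, (χ x : ZMod p) := by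
        rw [Finset.mul_sum]
        exact (Fintype.sum_equiv (Equiv.mulLeft χ₀) _ _ fun χ ↦ by simp).symm
      have h2 : ((χ₀ x : ZMod p) - 1) * ∑ χ : Γ ⧸ N →* (ZMod p)ˣ, (χ x : ZMod p) = 0 := by
        linear_combination -h1
      rcases mul_eq_zero.1 h2 with h3 | h3
      · exact absurd (Units.ext (by simpa [sub_eq_zero] using h3)) hχ₀
      · exact h3
    simp only [Φ]
    rw [Finset.sum_comm]
    simp_rw [← Finset.sum_mul]
    rw [Finset.sum_eq_single (1 : Γ ⧸ N)]
    · have : C σ 1 = ψ σ := by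
        have := hC σ hσ 1
        simpa using this
      rw [this]; simp
    · intro x _ hx
      rw [hz x hx, zero_mul]
    · simp
  -- By Cauchy's theorem, otherwise there would be a character of order p, but every character has
  -- order dividing p - 1.
  have hcard : (Fintype.card (Γ ⧸ N →* (ZMod p)ˣ) : ZMod p) ≠ 0 := by
    intro h
    rw [ZMod.natCast_eq_zero_iff] at h
    obtain ⟨χ, hχ⟩ := exists_prime_orderOf_dvd_card p h
    have h2 : orderOf χ ∣ p - 1 := by
      refine orderOf_dvd_of_pow_eq_one (MonoidHom.ext fun x ↦ ?_)
      exact ZMod.units_pow_card_sub_one_eq_one p (χ x)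
    rw [hχ] at h2
    have := (Fact.out : p.Prime).two_le
    have := Nat.le_of_dvd (by omega) h2
    omega
  obtain ⟨χ, -, hχ⟩ : ∃ χ ∈ Finset.univ, Φ χ σ ≠ 0 := by
    apply Finset.exists_ne_zero_of_sum_ne_zero
    rw [hsum]
    exact mul_ne_zero hcard hne
  refine ⟨χ.comp (QuotientGroup.mk' N), Φ χ, ?_, ?_, ?_, hχ, ?_⟩
  · intro g hg
    have : (QuotientGroup.mk' N g) = 1 := (QuotientGroup.eq_one_iff g).2 hg
    rw [MonoidHom.comp_apply, this, map_one]
  · intro g hg h hh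
    simp only [Φ, ← Finset.sum_add_distrib, ← mul_add]
    refine Finset.sum_congr rfl fun x _ ↦ ?_
    congr 1
    have : (s x)⁻¹ * (g * h) * s x = ((s x)⁻¹ * g * s x) * ((s x)⁻¹ * h * s x) := by group
    simp only [C, this]
    exact hψ _ (hconj _ _ hg) _ (hconj _ _ hh)
  · intro g τ hτ
    simp only [Φ, Finset.mul_sum]
    refine (Fintype.sum_equiv (Equiv.mulLeft (g : Γ ⧸ N)) _ _ fun x ↦ ?_).symm
    simp only [Equiv.coe_mulLeft, map_mul, Units.val_mul, MonoidHom.comp_apply,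
      QuotientGroup.mk'_apply, mul_assoc]
    congr 2
    rw [← hs x, ← QuotientGroup.mk_mul, ← mul_assoc, hC _ (hn.conj_mem τ hτ g), hC _ hτ]
    exact congrArg ψ (by group)
  -- Conjugation preserves U, so vanishing on U passes to the components; this is what keeps them
  -- continuous.
  · intro U hU h g hg
    refine Finset.sum_eq_zero fun x _ ↦ ?_
    have : C g x = 0 := h _ (by simpa using hU.conj_mem g hg (s x)⁻¹)
    rw [this, mul_zero]

end CrossedHoms
end SolvableDegreeP

namespace SolvableDegreeP

/-! ### Solvable transitive groups of prime degree. -/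

section SolvableTransitive

open MulAction

/-- A nontrivial solvable group has a nontrivial commutative normal subgroup. -/
theorem exists_normal_commutative (Q : Type*) [Group Q] [Nontrivial Q] [hQ : Group.IsSolvable Q] :
    ∃ A : Subgroup Q, A.Normal ∧ A ≠ ⊥ ∧ ∀ a ∈ A, ∀ b ∈ A, a * b = b * a := by
  classical
  have hex : ∃ n, derivedSeries Q n = ⊥ := hQ.solvable
  have hpos : Nat.find hex ≠ 0 := by
    intro h
    have := Nat.find_spec hex
    rw [h, derivedSeries_zero] at this
    exact top_ne_bot this
  obtain ⟨n, hn⟩ := Nat.exists_eq_succ_of_ne_zero hpos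
  refine ⟨derivedSeries Q n, derivedSeries_normal Q n, Nat.find_min hex (by omega), ?_⟩
  have h := Nat.find_spec hex
  rw [hn, derivedSeries_succ, Subgroup.commutator_eq_bot_iff_le_centralizer] at h
  intro a ha b hb
  exact (Subgroup.mem_centralizer_iff.1 (h ha) b hb).symm

/-- A solvable transitive permutation group of prime degree is affine. -/
theorem exists_isCrossedHom_of_index_prime {p : ℕ} [hp : Fact p.Prime] {G : Type*} [Group G]
    (H : Subgroup G) (hH : H.index = p)
    (hsol : Group.IsSolvable (MulAction.toPermHom G (G ⧸ H)).range) :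
    ∃ (θ : G →* (ZMod p)ˣ) (c : G → ZMod p), IsCrossedHom θ c ∧ (∀ g, c g = 0 ↔ g ∈ H) ∧
      (∃ τ, θ τ = 1 ∧ c τ ≠ 0) ∧ ∀ g ∈ H.normalCore, θ g = 1 := by
  classical
  set X := G ⧸ H
  have hX : Nat.card X = p := hH
  have hXp : (Nat.card X).Prime := hX ▸ hp.out
  have : Finite X := Nat.finite_of_card_ne_zero hXp.ne_zero
  have hXnt : Nontrivial X := Finite.one_lt_card_iff_nontrivial.1 hXp.one_lt
  set π := MulAction.toPermHom G X with hπ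
  set Q := π.range
  let x₀ : X := ((1 : G) : G ⧸ H)
  let ρ : G →* Q := π.rangeRestrict
  have hρ : ∀ (g : G) (x : X), ρ g • x = g • x := fun g x ↦ rfl
  have htrans : IsPretransitive Q X := ⟨fun x y ↦ by
    obtain ⟨g, hg⟩ := exists_smul_eq G x y
    exact ⟨ρ g, hg⟩⟩
  have hprim : IsPreprimitive Q X := IsPreprimitive.of_prime_card hXp
  have hQnt : Nontrivial Q := by
    obtain ⟨x, y, hxy⟩ := exists_pair_ne X
    obtain ⟨g, hg⟩ := exists_smul_eq Q x y
    exact ⟨g, 1, fun h ↦ hxy (by rw [← hg, h, one_smul])⟩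
  obtain ⟨A, hA, hAbot, hAcomm⟩ := exists_normal_commutative Q
  -- A nontrivial normal subgroup of a primitive group is transitive. Being commutative as well, A
  -- acts freely, so it has order p and plays the role of the translations.
  have hAt : IsPretransitive A X := by
    apply IsQuasiPreprimitive.isPretransitive_of_normal
    intro h
    apply hAbot
    rw [Subgroup.eq_bot_iff_forall]
    intro a ha
    apply FaithfulSMul.eq_of_smul_eq_smul (α := X)
    intro x
    have hx : x ∈ fixedPoints A X := h ▸ Set.mem_univ x
    rw [one_smul]
    exact hx ⟨a, ha⟩
  have hfree : ∀ a : A, a • x₀ = x₀ → a = 1 := by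
    intro a ha
    apply FaithfulSMul.eq_of_smul_eq_smul (α := X)
    intro x
    obtain ⟨b, rfl⟩ := exists_smul_eq A x₀ x
    have hcomm : a * b = b * a := Subtype.ext (hAcomm a a.2 b b.2)
    rw [one_smul, ← mul_smul, hcomm, mul_smul, ha]
  have hinj : Function.Injective fun a : A ↦ a • x₀ := by
    intro a b hab
    have : (b⁻¹ * a) • x₀ = x₀ := by
      rw [mul_smul]
      exact inv_smul_eq_iff.2 hab
    exact (inv_mul_eq_one.1 (hfree _ this)).symm
  have hcard : Nat.card A = p := by
    rw [← hX]
    exact Nat.card_eq_of_bijective _ ⟨hinj, fun x ↦ exists_smul_eq A x₀ x⟩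
  have hcyc : IsCyclic A := isCyclic_of_prime_card hcard
  obtain ⟨a₀, ha₀⟩ := hcyc.exists_generator
  let e : A ≃* Multiplicative (ZMod p) := (zmodMulEquivOfGenerator ha₀ hcard).symm
  let Θ : Q →* (ZMod p)ˣ := ((ZMod.AddAutEquivUnits p).toMultiplicative.toMonoidHom.comp
    ((MulAutMultiplicative (ZMod p)).toMonoidHom.comp (MulAut.congr e).toMonoidHom)).comp
      MulAut.conjNormal
  have hΘ : ∀ (q : Q) (a : A), (Θ q : ZMod p) * (e a).toAdd =
      (e (MulAut.conjNormal q a)).toAdd := by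
    intro q a
    let T : ZMod p →+ ZMod p :=
      { toFun := fun x ↦ (e (MulAut.conjNormal q (e.symm (.ofAdd x)))).toAdd
        map_zero' := by simp
        map_add' := fun x y ↦ by simp }
    have hT : ∀ x : ZMod p, T 1 * x = T x := fun x ↦ by
      rw [mul_comm, ← x.intCast_zmod_cast, ← zsmul_eq_mul, ← map_zsmul, zsmul_one]
    have h1 : (Θ q : ZMod p) = T 1 := rfl
    rw [h1, hT]
    simp [T]
  -- The translation part: a(g) is the unique element of A that agrees with g at the base point.
  -- Conjugation on A ≅ 𝔽_p is the linear part Θ, and commutativity of A gives the cocycle rule.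
  choose a ha using fun g : G ↦ exists_smul_eq A x₀ (g • x₀)
  have hmul : ∀ g h, a (g * h) = a g * MulAut.conjNormal (ρ g) (a h) := by
    intro g h
    apply hinj
    have hcomm : a g * MulAut.conjNormal (ρ g) (a h) = MulAut.conjNormal (ρ g) (a h) * a g :=
      Subtype.ext (hAcomm _ (a g).2 _ (MulAut.conjNormal (ρ g) (a h)).2)
    simp only [hcomm, ha, mul_smul]
    change _ = ((MulAut.conjNormal (ρ g) (a h) : A) : Q) • g • x₀
    rw [MulAut.conjNormal_apply, mul_smul, mul_smul, ← hρ g x₀, inv_smul_smul, hρ]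
    exact congrArg (g • ·) (ha h).symm
  refine ⟨Θ.comp ρ, fun g ↦ (e (a g)).toAdd, ?_, ?_, ?_, ?_⟩
  · intro g h
    simp only [hmul, map_mul, toAdd_mul, MonoidHom.comp_apply, hΘ]
  · intro g
    rw [toAdd_eq_zero, MulEquiv.map_eq_one_iff]
    have h1 : g ∈ H ↔ g • x₀ = x₀ := by
      rw [← MulAction.mem_stabilizer_iff, MulAction.stabilizer_quotient]
    rw [h1, ← ha]
    exact ⟨fun h ↦ by rw [h, one_smul], hfree _⟩
  · obtain ⟨τ, hτ⟩ := π.rangeRestrict_surjective (a₀ : Q)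
    have hne : e a₀ = Multiplicative.ofAdd 1 :=
      zmodMulEquivOfGenerator_symm_apply_generator ha₀ hcard
    have haτ : a τ = a₀ := by
      apply hinj
      simp only [ha]
      rw [← hρ]
      change π.rangeRestrict τ • x₀ = _
      rw [hτ]; rfl
    refine ⟨τ, ?_, by simp [haτ, hne]⟩
    have h1 := hΘ (ρ τ) a₀
    have h2 : MulAut.conjNormal (ρ τ) a₀ = a₀ := by
      apply Subtype.ext
      rw [MulAut.conjNormal_apply]
      change π.rangeRestrict τ * _ * _ = _
      rw [hτ]; simp
    rw [h2, hne] at h1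
    exact Units.ext (by simpa using h1)
  · intro g hg
    have : ρ g = 1 := by
      apply Subtype.ext
      rw [Subgroup.normalCore_eq_ker] at hg
      exact hg
    rw [MonoidHom.comp_apply, this, map_one]

end SolvableTransitive
end SolvableDegreeP

namespace SolvableDegreeP

/-! ### Continuous crossed homomorphisms on a compact group. -/

section Profinite

variable {p : ℕ} {Γ : Type*} [Group Γ]

/-- If p divided the index, Cauchy's theorem would give an element of order p in the quotient, whose
exponent divides p - 1. -/
theorem natCast_index_ne_zero [hp : Fact p.Prime] {N : Subgroup Γ} [N.FiniteIndex] (hn : N.Normal)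
    (hexp : ∀ g : Γ, g ^ (p - 1) ∈ N) : ((N.index : ℕ) : ZMod p) ≠ 0 := by
  intro h
  rw [ZMod.natCast_eq_zero_iff, Subgroup.index_eq_card] at h
  obtain ⟨x, hx⟩ := exists_prime_orderOf_dvd_card' p h
  obtain ⟨g, rfl⟩ := QuotientGroup.mk_surjective x
  have h2 : orderOf (g : Γ ⧸ N) ∣ p - 1 :=
    orderOf_dvd_of_pow_eq_one ((QuotientGroup.eq_one_iff (g ^ (p - 1))).2 (hexp g))
  rw [hx] at h2
  have := hp.out.two_le
  have := Nat.le_of_dvd (by omega) h2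
  omega

variable [TopologicalSpace Γ]

/-- `φ` vanishes on a neighbourhood of `1` in the subgroup `P`. -/
def IsSmoothOn (P : Subgroup Γ) (φ : Γ → ZMod p) : Prop :=
  ∃ U : Subgroup Γ, IsOpen (U : Set Γ) ∧ ∀ g ∈ P, g ∈ U → φ g = 0

/-- The pair `(θ, c)` describes a continuous homomorphism from `Γ` to the affine group of `𝔽_p`
whose image contains the translations. -/
def IsAffine (θ : Γ →* (ZMod p)ˣ) (c : Γ → ZMod p) : Prop :=
  IsCrossedHom θ c ∧ (∃ U : Subgroup Γ, IsOpen (U : Set Γ) ∧ ∀ u ∈ U, θ u = 1 ∧ c u = 0) ∧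
    ∃ τ, θ τ = 1 ∧ c τ ≠ 0

variable [IsTopologicalGroup Γ] [CompactSpace Γ]

theorem exists_isOpen_normal_le {U : Subgroup Γ} (hU : IsOpen (U : Set Γ)) :
    ∃ V : Subgroup Γ, IsOpen (V : Set Γ) ∧ V.Normal ∧ V.FiniteIndex ∧ V ≤ U := by
  have h1 : Finite (Γ ⧸ U) := U.quotient_finite_of_isOpen hU
  have h2 : U.FiniteIndex := Subgroup.finiteIndex_of_finite_quotient
  have h3 : U.normalCore.FiniteIndex := inferInstance
  refine ⟨U.normalCore, ?_, inferInstance, h3, U.normalCore_le⟩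
  exact U.normalCore.isOpen_of_isClosed_of_finiteIndex
    (U.normalCore_isClosed (U.isClosed_of_isOpen hU))

/-- P may have infinite index, so φ is first extended by zero over an open normal subgroup U on
which it vanishes. The product PU has finite index prime to p, and there the averaging argument
applies. -/
theorem exists_isAffine_of_isEquivariantOn [hp : Fact p.Prime] {P : Subgroup Γ} (hP : P.Normal)
    (hexp : ∀ g : Γ, g ^ (p - 1) ∈ P)
    {θ : Γ →* (ZMod p)ˣ} (hθ : ∀ g ∈ P, θ g = 1)
    {φ : Γ → ZMod p} (hφ : IsAddOn P φ) (hs : IsSmoothOn P φ) (heq : IsEquivariantOn θ P φ)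
    {τ : Γ} (hτ : τ ∈ P) (hne : φ τ ≠ 0) :
    ∃ c, IsAffine θ c ∧ ∀ g ∈ P, c g = φ g := by
  obtain ⟨U', hU'o, hU'⟩ := hs
  obtain ⟨U, hUo, hUn, hUf, hUle⟩ := exists_isOpen_normal_le hU'o
  have hU : ∀ g ∈ P, g ∈ U → φ g = 0 := fun g h1 h2 ↦ hU' g h1 (hUle h2)
  -- Continuity of θ is forced by φ: the commutator of u and τ lies in P ⊓ U, so θ(u) φ(τ) = φ(τ)
  -- with φ(τ) ≠ 0.
  have hθU : ∀ u ∈ U, θ u = 1 := by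
    intro u hu
    have h1 : u * τ * u⁻¹ * τ⁻¹ ∈ U := by
      have h := U.mul_mem hu (hUn.conj_mem _ (U.inv_mem hu) τ)
      simpa [mul_assoc] using h
    have h2 : u * τ * u⁻¹ ∈ P := hP.conj_mem τ hτ u
    have h3 := hU _ (P.mul_mem h2 (P.inv_mem hτ)) h1
    rw [hφ _ h2 _ (P.inv_mem hτ), hφ.map_inv hτ, heq u τ hτ] at h3
    have h4 : ((θ u : ZMod p) - 1) * φ τ = 0 := by linear_combination h3
    rcases mul_eq_zero.1 h4 with h5 | h5
    · exact Units.ext (by simpa [sub_eq_zero] using h5)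
    · exact absurd h5 hne
  obtain ⟨ψ, hψ, hψP, hψU, hψeq⟩ := exists_extend_sup hP hUn hφ hU
  have hNf : (P ⊔ U).FiniteIndex := Subgroup.finiteIndex_of_le le_sup_right
  have hNn : (P ⊔ U).Normal := inferInstance
  have hθN : ∀ g ∈ P ⊔ U, θ g = 1 := by
    have : P ⊔ U ≤ θ.ker := sup_le hθ hθU
    exact this
  obtain ⟨c, hc, hcN⟩ := exists_isCrossedHom_of_index
    (natCast_index_ne_zero hNn fun g ↦ (le_sup_left : P ≤ P ⊔ U) (hexp g)) hθN hψ (hψeq θ heq) hNn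
  have hcP : ∀ g ∈ P, c g = φ g := fun g hg ↦ by
    rw [hcN g ((le_sup_left : P ≤ P ⊔ U) hg), hψP g hg]
  refine ⟨c, ⟨hc, ⟨U, hUo, fun u hu ↦ ⟨hθU u hu, ?_⟩⟩, τ, hθ τ hτ, by rwa [hcP τ hτ]⟩, hcP⟩
  rw [hcN u ((le_sup_right : U ≤ P ⊔ U) hu), hψU u hu]

/-- Without equivariance, extend φ to PU as before and split it into eigencomponents; some component
is nonzero at σ, and that one extends to a crossed homomorphism. -/
theorem exists_isAffine_apply_ne_zero [hp : Fact p.Prime] {P : Subgroup Γ} (hP : P.Normal)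
    (hexp : ∀ g : Γ, g ^ (p - 1) ∈ P)
    (hcomm : ∀ g h : Γ, g * h * g⁻¹ * h⁻¹ ∈ P)
    {φ : Γ → ZMod p} (hφ : IsAddOn P φ) (hs : IsSmoothOn P φ) {σ : Γ} (hσ : σ ∈ P)
    (hne : φ σ ≠ 0) : ∃ θ c, IsAffine (p := p) θ c ∧ c σ ≠ 0 := by
  obtain ⟨U', hU'o, hU'⟩ := hs
  obtain ⟨U, hUo, hUn, hUf, hUle⟩ := exists_isOpen_normal_le hU'o
  have hU : ∀ g ∈ P, g ∈ U → φ g = 0 := fun g h1 h2 ↦ hU' g h1 (hUle h2)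
  obtain ⟨ψ, hψ, hψP, hψU, -⟩ := exists_extend_sup hP hUn hφ hU
  have hNf : (P ⊔ U).FiniteIndex := Subgroup.finiteIndex_of_le le_sup_right
  have hNn : (P ⊔ U).Normal := inferInstance
  have hle : P ≤ P ⊔ U := le_sup_left
  obtain ⟨θ, φ', hθ, hφ', heq, hne', hU0⟩ := exists_isEquivariantOn_ne_zero hNn
    (fun g h ↦ hle (hcomm g h)) (fun g ↦ hle (hexp g)) hψ (hle hσ) (by rwa [hψP σ hσ])
  obtain ⟨c, hc, hcP⟩ := exists_isAffine_of_isEquivariantOn hP hexp (fun g hg ↦ hθ g (hle hg))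
    (hφ'.mono hle) ⟨U, hUo, fun g _ hg ↦ hU0 U hUn hψU g hg⟩ (fun g h hh ↦ heq g h (hle hh)) hσ hne'
  exact ⟨θ, c, hc, by rwa [hcP σ hσ]⟩

end Profinite
end SolvableDegreeP

namespace SolvableDegreeP

open IntermediateField

/-! ### Solvable extensions of degree p as affine pairs. -/

section SolvableExtensions

theorem isSolvable_of_ker_le {G A B : Type*} [Group G] [Group A] [Group B] (f : G →* A)
    (hf : Function.Surjective f) (g : G →* B) (hg : Function.Surjective g) (h : f.ker ≤ g.ker)
    [Group.IsSolvable A] : Group.IsSolvable B := by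
  refine Group.isSolvable_of_surjective (f := f.liftOfSurjective hf ⟨g, h⟩) fun b ↦ ?_
  obtain ⟨a, rfl⟩ := hg b
  exact ⟨f a, MonoidHom.liftOfRightInverse_comp_apply ..⟩

variable {p : ℕ}

/-- The intersection of the kernel of `θ` with the zeros of `c` is the kernel of the homomorphism
to the affine group. -/
theorem IsCrossedHom.normal_ker_inf_zeros {Γ : Type*} [Group Γ] {θ : Γ →* (ZMod p)ˣ}
    {c : Γ → ZMod p} (hc : IsCrossedHom θ c) : (θ.ker ⊓ hc.zeros).Normal := by
  refine ⟨fun n hn g ↦ ⟨?_, ?_⟩⟩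
  · exact (MonoidHom.normal_ker θ).conj_mem n hn.1 g
  · have h2 : c n = 0 := hn.2
    change c _ = 0
    rw [hc.isEquivariantOn (N := θ.ker) (fun g hg ↦ hg) g n hn.1, h2, mul_zero]

/-- The affine group is metabelian: commutators lie in ker θ, where c is a homomorphism to a
commutative group, so the second derived subgroup is killed by both θ and c. -/
theorem IsCrossedHom.isSolvable_of_ker_inf_zeros_le {Γ B : Type*} [Group Γ] [Group B]
    {θ : Γ →* (ZMod p)ˣ} {c : Γ → ZMod p} (hc : IsCrossedHom θ c) (g : Γ →* B)
    (hg : Function.Surjective g) (h : θ.ker ⊓ hc.zeros ≤ g.ker) : Group.IsSolvable B := by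
  refine ⟨2, ?_⟩
  rw [← map_derivedSeries_eq hg, Subgroup.map_eq_bot_iff]
  refine le_trans ?_ h
  have h1 : derivedSeries Γ 1 ≤ θ.ker := by
    rw [derivedSeries_one]
    exact Abelianization.commutator_subset_ker θ
  rw [derivedSeries_succ, Subgroup.commutator_le]
  intro a ha b hb
  have ha := h1 ha
  have hb := h1 hb
  have hadd := hc.isAddOn (N := θ.ker) fun g hg ↦ hg
  refine ⟨?_, ?_⟩
  · exact θ.ker.mul_mem (θ.ker.mul_mem (θ.ker.mul_mem ha hb) (θ.ker.inv_mem ha)) (θ.ker.inv_mem hb)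
  · change c _ = 0
    rw [commutatorElement_def, hadd _ ((MonoidHom.normal_ker θ).conj_mem b hb a) _
      (θ.ker.inv_mem hb), hadd.map_conj ha hb, hadd.map_inv hb, add_neg_cancel]

/-- c separates the left cosets of its zeros, and the powers of a τ in ker θ with c(τ) ≠ 0 already
take every value in 𝔽_p. -/
theorem IsCrossedHom.index_zeros [Fact p.Prime] {Γ : Type*} [Group Γ]
    {θ : Γ →* (ZMod p)ˣ} {c : Γ → ZMod p} (hc : IsCrossedHom θ c)
    (hne : ∃ τ, θ τ = 1 ∧ c τ ≠ 0) : hc.zeros.index = p := by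
  have key : ∀ g h, c g = c h ↔ g⁻¹ * h ∈ hc.zeros := by
    intro g h
    have h1 : (θ g : ZMod p) * c (g⁻¹ * h) = c h - c g := by
      rw [hc, mul_add, hc.map_inv, _root_.map_inv, ← mul_assoc, Units.mul_inv]; ring
    rw [hc.mem_zeros, ← Units.mul_right_eq_zero (θ g), h1, sub_eq_zero, eq_comm]
  let f : Γ ⧸ hc.zeros → ZMod p := Quotient.lift c fun a b hab ↦
    (key a b).2 (QuotientGroup.leftRel_apply.1 hab)
  have hinj : Function.Injective f := by
    rintro ⟨a⟩ ⟨b⟩ hab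
    exact QuotientGroup.eq.2 ((key a b).1 hab)
  have hsurj : Function.Surjective f := by
    intro x
    obtain ⟨τ, hτ, hcτ⟩ := hne
    refine ⟨((τ ^ (x * (c τ)⁻¹).val : Γ) : Γ ⧸ hc.zeros), ?_⟩
    change c _ = x
    rw [(hc.isAddOn (N := θ.ker) fun g hg ↦ hg).map_pow hτ, ZMod.natCast_val, ZMod.cast_id,
      inv_mul_cancel_right₀ hcτ]
  rw [Subgroup.index_eq_card, Nat.card_eq_of_bijective f ⟨hinj, hsurj⟩, Nat.card_zmod]

variable {F Ω : Type*} [Field F] [Field Ω] [Algebra F Ω]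

theorem fixingSubgroup_fixedField_of_isClosed [IsGalois F Ω] {H : Subgroup Gal(Ω/F)}
    (hH : IsClosed (H : Set Gal(Ω/F))) : (fixedField H).fixingSubgroup = H :=
  InfiniteGalois.fixingSubgroup_fixedField ⟨H, hH⟩

theorem IsAffine.isOpen_zeros {Γ : Type*} [Group Γ] [TopologicalSpace Γ] [IsTopologicalGroup Γ]
    {θ : Γ →* (ZMod p)ˣ} {c : Γ → ZMod p} (h : IsAffine θ c) : IsOpen (h.1.zeros : Set Γ) := by
  obtain ⟨U, hU, h1⟩ := h.2.1
  exact Subgroup.isOpen_mono (fun u hu ↦ (h1 u hu).2) hU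

theorem IsAffine.isOpen_ker {Γ : Type*} [Group Γ] [TopologicalSpace Γ] [IsTopologicalGroup Γ]
    {θ : Γ →* (ZMod p)ˣ} {c : Γ → ZMod p} (h : IsAffine θ c) : IsOpen (θ.ker : Set Γ) := by
  obtain ⟨U, hU, h1⟩ := h.2.1
  exact Subgroup.isOpen_mono (fun u hu ↦ (h1 u hu).1) hU

/-- The solvable extensions of degree `p` are the fixed fields of the zeros of the crossed
homomorphisms to `𝔽_p` which do not vanish on the kernel of their character. -/
theorem isSolvableExt_iff [Fact p.Prime] [IsGalois F Ω] (E : IntermediateField F Ω) :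
    IsSolvableExt p F E ↔ ∃ (θ : Gal(Ω/F) →* (ZMod p)ˣ) (c : Gal(Ω/F) → ZMod p)
      (h : IsAffine θ c), E = fixedField h.1.zeros := by
  constructor
  · rintro ⟨hdeg, -, hsol⟩
    have hidx : E.fixingSubgroup.index = p := by rw [← finrank_eq_fixingSubgroup_index, hdeg]
    have hfin : FiniteDimensional F E :=
      FiniteDimensional.of_finrank_pos (hdeg ▸ (Fact.out : p.Prime).pos)
    have hN : Normal F (normalClosure F E Ω) := normalClosure.normal F E Ω
    -- The fixing group of the normal closure is normal and contained in that of E, hence in its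
    -- normal core, the kernel of the action on cosets. So the permutation group is a quotient of
    -- the solvable Galois group.
    have hker : (AlgEquiv.restrictNormalHom (F := F) (K₁ := Ω) (normalClosure F E Ω)).ker ≤
        (MulAction.toPermHom Gal(Ω/F) (Gal(Ω/F) ⧸ E.fixingSubgroup)).rangeRestrict.ker := by
      rw [MonoidHom.ker_rangeRestrict, ← Subgroup.normalCore_eq_ker, restrictNormalHom_ker]
      have hn : (normalClosure F E Ω).fixingSubgroup.Normal := by
        rw [← restrictNormalHom_ker]; exact MonoidHom.normal_ker _
      exact Subgroup.normal_le_normalCore.2 (fixingSubgroup_le E.le_normalClosure)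
    have hsol' := isSolvable_of_ker_le _ (AlgEquiv.restrictNormalHom_surjective Ω) _
      (MonoidHom.rangeRestrict_surjective _) hker
    obtain ⟨θ, c, hc, hc0, hne, hθ⟩ := exists_isCrossedHom_of_index_prime _ hidx hsol'
    obtain ⟨U, hUo, hUn, -, hUle⟩ := exists_isOpen_normal_le (fixingSubgroup_isOpen E)
    have hA : IsAffine θ c := ⟨hc, ⟨U, hUo, fun u hu ↦
      ⟨hθ u (Subgroup.normal_le_normalCore.2 hUle hu), (hc0 u).2 (hUle hu)⟩⟩, hne⟩
    refine ⟨θ, c, hA, ?_⟩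
    have : hA.1.zeros = E.fixingSubgroup := Subgroup.ext fun g ↦ hc0 g
    rw [this, InfiniteGalois.fixedField_fixingSubgroup]
  · rintro ⟨θ, c, h, rfl⟩
    have hcl := h.1.zeros.isClosed_of_isOpen h.isOpen_zeros
    refine ⟨?_, inferInstance, ?_⟩
    · rw [finrank_eq_fixingSubgroup_index, fixingSubgroup_fixedField_of_isClosed hcl,
        h.1.index_zeros h.2.2]
    · have hN : Normal F (normalClosure F (fixedField h.1.zeros) Ω) := normalClosure.normal F _ Ω
      refine h.1.isSolvable_of_ker_inf_zeros_le
        (AlgEquiv.restrictNormalHom (F := F) (K₁ := Ω) (normalClosure F (fixedField h.1.zeros) Ω))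
        (AlgEquiv.restrictNormalHom_surjective Ω) ?_
      rw [restrictNormalHom_ker, ← le_iff_le]
      have hcl' : IsClosed ((θ.ker ⊓ h.1.zeros : Subgroup Gal(Ω/F)) : Set Gal(Ω/F)) := by
        rw [Subgroup.coe_inf]
        exact (θ.ker.isClosed_of_isOpen h.isOpen_ker).inter hcl
      -- This Galois extension contains the field in question, so it contains the normal closure.
      have hgal : IsGalois F (fixedField (θ.ker ⊓ h.1.zeros)) := by
        rw [← InfiniteGalois.normal_iff_isGalois, fixingSubgroup_fixedField_of_isClosed hcl']
        exact h.1.normal_ker_inf_zeros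
      rw [normalClosure_le_iff_of_normal]
      exact fixedField_antitone inf_le_right

theorem fixingSubgroup_iSup {ι : Sort*} (L : ι → IntermediateField F Ω) :
    (⨆ i, L i).fixingSubgroup = ⨅ i, (L i).fixingSubgroup := by
  apply eq_of_forall_le_iff
  intro H
  simp only [le_iInf_iff, ← le_iff_le, iSup_le_iff]

theorem fixingSubgroup_solvableCompositum [Fact p.Prime] [IsGalois F Ω] (g : Gal(Ω/F)) :
    g ∈ (solvableCompositum p F Ω).fixingSubgroup ↔
      ∀ (θ : Gal(Ω/F) →* (ZMod p)ˣ) (c : Gal(Ω/F) → ZMod p), IsAffine θ c → θ g = 1 ∧ c g = 0 := by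
  simp only [solvableCompositum, fixingSubgroup_iSup, Subgroup.mem_iInf, isSolvableExt_iff]
  constructor
  · intro h
    have h0 : ∀ (θ : Gal(Ω/F) →* (ZMod p)ˣ) (c : Gal(Ω/F) → ZMod p), IsAffine θ c → c g = 0 := by
      intro θ c hA
      have h1 := h _ ⟨θ, c, hA, rfl⟩
      rwa [fixingSubgroup_fixedField_of_isClosed (Subgroup.isClosed_of_isOpen _ hA.isOpen_zeros)]
        at h1
    intro θ c hA
    refine ⟨?_, h0 θ c hA⟩
    obtain ⟨U, hU, h1⟩ := hA.2.1
    obtain ⟨τ, hτ, hcτ⟩ := hA.2.2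
    -- The pair (θ, c + 1 - θ) is again affine, with the same U and τ. Vanishing of both crossed
    -- homomorphisms at g gives θ(g) = 1.
    have h2 := h0 θ _ ⟨hA.1.add_coboundary 1, ⟨U, hU, fun u hu ↦ ⟨(h1 u hu).1, by
      simp [(h1 u hu).1, (h1 u hu).2]⟩⟩, τ, hτ, by simpa [hτ] using hcτ⟩
    rw [h0 θ c hA, zero_add, mul_one, sub_eq_zero] at h2
    exact Units.ext (by simpa using h2.symm)
  · rintro h _ ⟨θ, c, hA, rfl⟩
    rw [fixingSubgroup_fixedField_of_isClosed (Subgroup.isClosed_of_isOpen _ hA.isOpen_zeros)]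
    exact (h θ c hA).2

end SolvableExtensions
end SolvableDegreeP

namespace SolvableDegreeP

open IntermediateField

/-! ### The field K and its characters. -/

section FieldK

variable (p : ℕ) (F Ω : Type*) [Field F] [Field Ω] [Algebra F Ω]

instance normal_fieldK : Normal F (fieldK p F Ω) := by
  have e : fieldK p F Ω =
      ⨆ L : {L : IntermediateField F Ω // IsCyclicExtOfDegreeDvd (p - 1) F L}, L.1 :=
    iSup_subtype'
  have h : ∀ L : {L : IntermediateField F Ω // IsCyclicExtOfDegreeDvd (p - 1) F L},
      Normal F L.1 := fun L ↦ L.2.2.1.to_normal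
  rw [e]
  exact normal_iSup F Ω _

variable {F Ω} in
theorem mem_fixingSubgroup_fieldK (g : Gal(Ω/F)) :
    g ∈ (fieldK p F Ω).fixingSubgroup ↔
      ∀ L : IntermediateField F Ω, IsCyclicExtOfDegreeDvd (p - 1) F L → g ∈ L.fixingSubgroup := by
  simp only [fieldK, fixingSubgroup_iSup, Subgroup.mem_iInf]

variable {F Ω} in
theorem pow_mem_fixingSubgroup_fieldK (g : Gal(Ω/F)) :
    g ^ (p - 1) ∈ (fieldK p F Ω).fixingSubgroup := by
  rw [mem_fixingSubgroup_fieldK]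
  rintro L ⟨hfin, hgal, hcyc, hdvd⟩
  rw [← restrictNormalHom_ker, MonoidHom.mem_ker, map_pow, ← orderOf_dvd_iff_pow_eq_one]
  rw [← IsGalois.card_aut_eq_finrank] at hdvd
  exact (orderOf_dvd_natCard _).trans hdvd

instance normal_fixingSubgroup_fieldK : (fieldK p F Ω).fixingSubgroup.Normal := by
  rw [← restrictNormalHom_ker]; exact MonoidHom.normal_ker _

variable {F Ω p} in
-- The fixed field of ker θ has Galois group embedded in 𝔽_pˣ, so it is cyclic of degree dividing p
-- - 1 and is one of the fields that generate K.
theorem fixingSubgroup_fieldK_le_ker [Fact p.Prime] [IsGalois F Ω] {θ : Gal(Ω/F) →* (ZMod p)ˣ}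
    (hθ : IsOpen (θ.ker : Set Gal(Ω/F))) : (fieldK p F Ω).fixingSubgroup ≤ θ.ker := by
  have hcl := θ.ker.isClosed_of_isOpen hθ
  have hfix := fixingSubgroup_fixedField_of_isClosed hcl
  set L := fixedField θ.ker with hL
  have hgal : IsGalois F L := by
    rw [← InfiniteGalois.normal_iff_isGalois, hfix]
    exact MonoidHom.normal_ker θ
  have hfin : FiniteDimensional F L := by
    rw [← InfiniteGalois.isOpen_iff_finite]
    change IsOpen (L.fixingSubgroup : Set Gal(Ω/F))
    rwa [hfix]
  have hker : (AlgEquiv.restrictNormalHom (F := F) (K₁ := Ω) L).ker = θ.ker := by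
    rw [restrictNormalHom_ker, hfix]
  have hsurj := AlgEquiv.restrictNormalHom_surjective (F := F) (K₁ := L) Ω
  let f : Gal(L/F) →* (ZMod p)ˣ :=
    (AlgEquiv.restrictNormalHom L).liftOfSurjective hsurj ⟨θ, hker.le⟩
  have hf : ∀ g, f (AlgEquiv.restrictNormalHom L g) = θ g := fun g ↦
    MonoidHom.liftOfRightInverse_comp_apply ..
  have hinj : Function.Injective f := by
    rw [injective_iff_map_eq_one]
    intro x hx
    obtain ⟨g, rfl⟩ := hsurj x
    rw [hf] at hx
    exact hker.ge hx
  have hcyc : IsCyclic Gal(L/F) := isCyclic_of_injective f hinj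
  have hdvd : Module.finrank F L ∣ p - 1 := by
    rw [← IsGalois.card_aut_eq_finrank]
    have := Subgroup.card_dvd_of_injective f hinj
    rwa [Nat.card_eq_fintype_card (α := (ZMod p)ˣ), ZMod.card_units_eq_totient,
      Nat.totient_prime Fact.out] at this
  have hle : L ≤ fieldK p F Ω := le_iSup₂_of_le L ⟨hfin, hgal, hcyc, hdvd⟩ le_rfl
  rw [← hfix]
  exact fixingSubgroup_le hle

variable [Fact p.Prime] [IsSepClosure F Ω]

/-- The character of `Gal(Ω/F)` through which the Galois group acts on the extension of degree `p`
of `K` attached to an eigenvector for `χ`. -/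
noncomputable def twist (χ : Gal((fieldK p F Ω)/F) →* (ZMod p)ˣ) : Gal(Ω/F) →* (ZMod p)ˣ :=
  (omega p F Ω * χ⁻¹).comp (AlgEquiv.restrictNormalHom (fieldK p F Ω))

/-- Moves F_χ from Gal(K/F) to Gal(Ω/F), where the fixing subgroups are compared. -/
theorem fieldChi_eq (χ : Gal((fieldK p F Ω)/F) →* (ZMod p)ˣ) :
    fieldChi p F Ω χ = fixedField (twist p F Ω χ).ker := by
  have : IsGalois F Ω := IsSepClosure.isGalois
  have hle : (fieldK p F Ω).fixingSubgroup ≤ (twist p F Ω χ).ker := by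
    intro g hg
    rw [← restrictNormalHom_ker, MonoidHom.mem_ker] at hg
    rw [MonoidHom.mem_ker, twist, MonoidHom.comp_apply, hg, map_one]
  ext x
  rw [mem_fixedField_iff]
  constructor
  · intro hx
    have hxK : x ∈ fieldK p F Ω := lift_le _ hx
    rw [fieldChi, show x = ((⟨x, hxK⟩ : fieldK p F Ω) : Ω) from rfl, mem_lift,
      mem_fixedField_iff] at hx
    intro g hg
    have := hx (AlgEquiv.restrictNormalHom (fieldK p F Ω) g) hg
    have h2 := AlgEquiv.restrictNormal_commutes g (fieldK p F Ω) ⟨x, hxK⟩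
    have h3 : g.restrictNormal (fieldK p F Ω) ⟨x, hxK⟩ = ⟨x, hxK⟩ := this
    rw [h3] at h2
    exact h2.symm
  · intro hx
    have hxK : x ∈ fieldK p F Ω := by
      rw [← InfiniteGalois.fixedField_fixingSubgroup (fieldK p F Ω), mem_fixedField_iff]
      exact fun g hg ↦ hx g (hle hg)
    rw [fieldChi, show x = ((⟨x, hxK⟩ : fieldK p F Ω) : Ω) from rfl, mem_lift,
      mem_fixedField_iff]
    intro σ hσ
    obtain ⟨g, rfl⟩ := AlgEquiv.restrictNormalHom_surjective (F := F) (K₁ := fieldK p F Ω) Ω σ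
    apply Subtype.ext
    have h2 := AlgEquiv.restrictNormal_commutes g (fieldK p F Ω) ⟨x, hxK⟩
    exact h2.trans (hx g hσ)

end FieldK
end SolvableDegreeP

namespace SolvableDegreeP

open IntermediateField

/-! ### Generators of degree-p extensions, by resolvents. -/

section HilbertNinety

variable {p : ℕ}

/-- Dedekind's independence of automorphisms. -/
theorem exists_sum_mul_apply_ne_zero {F L : Type*} [Field F] [Field L] [Algebra F L]
    (R : Subgroup Gal(L/F)) [Fintype R] (f : R → L) (hf : f 1 ≠ 0) :
    ∃ z : L, ∑ r : R, f r * (r : Gal(L/F)) z ≠ 0 := by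
  by_contra! h
  have hli : LinearIndependent L (fun r : R ↦ ((r : Gal(L/F)) : L → L)) :=
    LinearIndependent.comp (linearIndependent_monoidHom L L)
      (fun r : R ↦ ((r : Gal(L/F)) : L →* L)) (fun x y hxy ↦ Subtype.ext <| AlgEquiv.ext fun z ↦
        DFunLike.congr_fun hxy z)
  refine hf (Fintype.linearIndependent_iff.1 hli f ?_ 1)
  ext z
  simpa using h z

/-- β is a Lagrange resolvent: the sum of ζ^(-φ(s)) s(z) over s in R, with z chosen so that it is
nonzero. -/
theorem exists_apply_eq_pow_mul [Fact p.Prime] {F L : Type*} [Field F] [Field L] [Algebra F L]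
    (R : Subgroup Gal(L/F)) [Finite R] {φ : Gal(L/F) → ZMod p} (hφ : IsAddOn R φ) {ζ : L}
    (hζ : ζ ^ p = 1) (hR : ∀ r ∈ R, r ζ = ζ) :
    ∃ β : L, β ≠ 0 ∧ ∀ r ∈ R, r β = ζ ^ (φ r).val * β := by
  have := Fintype.ofFinite R
  let e := AddChar.zmodChar p hζ
  have he : ∀ x, e x = ζ ^ x.val := AddChar.zmodChar_apply hζ
  have hRe : ∀ r ∈ R, ∀ x, r (e x) = e x := fun r hr x ↦ by rw [he, map_pow, hR r hr]
  obtain ⟨z, hz⟩ := exists_sum_mul_apply_ne_zero R (fun r ↦ e (-φ r)) (by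
    rw [he]
    refine pow_ne_zero _ fun h0 ↦ ?_
    rw [h0, zero_pow (Fact.out : p.Prime).ne_zero] at hζ
    exact zero_ne_one hζ)
  refine ⟨_, hz, fun r hr ↦ ?_⟩
  rw [← he, map_sum, Finset.mul_sum]
  refine Fintype.sum_equiv (Equiv.mulLeft (⟨r, hr⟩ : R)) _ _ fun s ↦ ?_
  have h1 : φ (r * s) = φ r + φ s := hφ r hr s s.2
  simp only [Equiv.coe_mulLeft, Subgroup.coe_mul, map_mul, hRe r hr, h1, AlgEquiv.mul_apply,
    ← mul_assoc, ← AddChar.map_add_eq_mul]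
  congr 2
  ring_nf

/-- The additive resolvent: with T the sum of s(z), nonzero for suitable z, and S the sum of φ(s)
s(z), one has r(S) = S - φ(r) T, so β = -S/T works. -/
theorem exists_apply_eq_add {F L : Type*} [Field F] [Field L] [Algebra F L]
    (R : Subgroup Gal(L/F)) [Finite R] [CharP L p] {φ : Gal(L/F) → ZMod p} (hφ : IsAddOn R φ) :
    ∃ β : L, ∀ r ∈ R, r β = β + ZMod.castHom dvd_rfl L (φ r) := by
  have := Fintype.ofFinite R
  set ι := ZMod.castHom dvd_rfl L with hι
  have hRι : ∀ (r : Gal(L/F)) x, r (ι x) = ι x := fun r x ↦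
    RingHom.congr_fun (Subsingleton.elim ((r : L →+* L).comp ι) ι) x
  obtain ⟨z, hz⟩ := exists_sum_mul_apply_ne_zero R (fun _ ↦ 1) one_ne_zero
  simp only [one_mul] at hz
  set T := ∑ r : R, (r : Gal(L/F)) z with hT
  have hTr : ∀ r ∈ R, r T = T := fun r hr ↦ by
    rw [hT, map_sum]
    exact Fintype.sum_equiv (Equiv.mulLeft (⟨r, hr⟩ : R)) _ _ fun s ↦ rfl
  refine ⟨-(∑ r : R, ι (φ r) * (r : Gal(L/F)) z) / T, fun r hr ↦ ?_⟩
  have h1 : r (∑ s : R, ι (φ s) * (s : Gal(L/F)) z) =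
      (∑ s : R, ι (φ s) * (s : Gal(L/F)) z) - ι (φ r) * T := by
    have h2 : (∑ s : R, ι (φ s) * (s : Gal(L/F)) z) - ι (φ r) * T =
        ∑ s : R, (ι (φ (r * s)) - ι (φ r)) * (r * (s : Gal(L/F))) z := by
      simp only [sub_mul, Finset.sum_sub_distrib]
      congr 1
      · exact (Fintype.sum_equiv (Equiv.mulLeft (⟨r, hr⟩ : R)) _ _ fun s ↦ rfl).symm
      · rw [← hTr r hr, hT, map_sum, Finset.mul_sum]
        rfl
    rw [h2, map_sum]
    refine Finset.sum_congr rfl fun s _ ↦ ?_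
    rw [hφ r hr s s.2, map_add, add_sub_cancel_left, map_mul, hRι]
    rfl
  rw [map_div₀, map_neg, hTr r hr, h1]
  field_simp
  ring

variable [Fact p.Prime] {F Ω : Type*} [Field F] [Field Ω] [Algebra F Ω] [IsGalois F Ω]

/-- Continuity lets φ factor through a finite Galois group, where the resolvents are finite sums; L
is enlarged to contain ζ, which the multiplicative resolvent needs. -/
theorem exists_finite_factor {K : IntermediateField F Ω} {φ : Gal(Ω/F) → ZMod p}
    (hφ : IsAddOn K.fixingSubgroup φ) (hs : IsSmoothOn K.fixingSubgroup φ) (ζ : Ω) :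
    ∃ (L : IntermediateField F Ω) (_ : FiniteDimensional F L) (_ : Normal F L)
      (φ' : Gal(L/F) → ZMod p), ζ ∈ L ∧
      IsAddOn (K.fixingSubgroup.map (AlgEquiv.restrictNormalHom L)) φ' ∧
      ∀ g ∈ K.fixingSubgroup, φ' (AlgEquiv.restrictNormalHom L g) = φ g := by
  classical
  obtain ⟨U₁, hU₁, h1⟩ := hs
  have hζint : IsIntegral F ζ := Algebra.IsIntegral.isIntegral ζ
  have : FiniteDimensional F F⟮ζ⟯ := adjoin.finiteDimensional hζint
  obtain ⟨U, hUo, hUn, -, hU⟩ := exists_isOpen_normal_le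
    (U := U₁ ⊓ F⟮ζ⟯.fixingSubgroup) (hU₁.inter (fixingSubgroup_isOpen _))
  have hfix := fixingSubgroup_fixedField_of_isClosed (U.isClosed_of_isOpen hUo)
  set L := fixedField U
  have hgal : FiniteDimensional F L ∧ IsGalois F L := by
    rw [← InfiniteGalois.isOpen_and_normal_iff_finite_and_isGalois]
    change IsOpen (L.fixingSubgroup : Set Gal(Ω/F)) ∧ _
    rw [hfix]
    exact ⟨hUo, hUn⟩
  have hn : Normal F L := hgal.2.to_normal
  have hker : (AlgEquiv.restrictNormalHom (F := F) (K₁ := Ω) L).ker = U := by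
    rw [restrictNormalHom_ker, hfix]
  set π := AlgEquiv.restrictNormalHom (F := F) (K₁ := Ω) L
  let φ' : Gal(L/F) → ZMod p := fun r ↦
    if h : ∃ g ∈ K.fixingSubgroup, π g = r then φ h.choose else 0
  have hφ' : ∀ g ∈ K.fixingSubgroup, φ' (π g) = φ g := by
    intro g hg
    have h : ∃ g' ∈ K.fixingSubgroup, π g' = π g := ⟨g, hg, rfl⟩
    have e : φ' (π g) = φ h.choose := dif_pos h
    rw [e]
    obtain ⟨h2, h3⟩ := h.choose_spec
    set g' := h.choose
    have h4 : g⁻¹ * g' ∈ U := by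
      rw [← hker, MonoidHom.mem_ker, map_mul, map_inv, h3, inv_mul_cancel]
    have h5 := h1 _ (mul_mem (inv_mem hg) h2) (hU h4).1
    rw [hφ _ (inv_mem hg) _ h2, hφ.map_inv hg] at h5
    linear_combination h5
  refine ⟨L, hgal.1, hn, φ', ?_, ?_, hφ'⟩
  · rw [mem_fixedField_iff]
    intro g hg
    exact (mem_fixingSubgroup_iff _ g).1 (hU hg).2 ζ (mem_adjoin_simple_self F ζ)
  · rintro _ ⟨g, hg, rfl⟩ _ ⟨h, hh, rfl⟩
    rw [← map_mul, hφ' _ (mul_mem hg hh), hφ' g hg, hφ' h hh, hφ g hg h hh]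

theorem exists_kummer_generator {K : IntermediateField F Ω} {φ : Gal(Ω/F) → ZMod p}
    (hφ : IsAddOn K.fixingSubgroup φ) (hs : IsSmoothOn K.fixingSubgroup φ) {ζ : Ω}
    (hζ : ζ ^ p = 1) (hζK : ζ ∈ K) :
    ∃ α : Ω, α ≠ 0 ∧ ∀ g ∈ K.fixingSubgroup, g α = ζ ^ (φ g).val * α := by
  obtain ⟨L, _, _, φ', hζL, hφ', h⟩ := exists_finite_factor hφ hs ζ
  obtain ⟨β, hβ, h1⟩ := exists_apply_eq_pow_mul _ hφ' (ζ := (⟨ζ, hζL⟩ : L))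
    (Subtype.ext hζ) (by
      rintro _ ⟨g, hg, rfl⟩
      apply Subtype.ext
      exact (AlgEquiv.restrictNormal_commutes g L ⟨ζ, hζL⟩).trans
        ((mem_fixingSubgroup_iff _ g).1 hg ζ hζK))
  refine ⟨β, by simpa using hβ, fun g hg ↦ ?_⟩
  rw [← h g hg]
  have h2 := h1 _ ⟨g, hg, rfl⟩
  exact (AlgEquiv.restrictNormal_commutes g L β).symm.trans (congrArg (Subtype.val) h2)

theorem exists_artinSchreier_generator [CharP Ω p] {K : IntermediateField F Ω}
    {φ : Gal(Ω/F) → ZMod p} (hφ : IsAddOn K.fixingSubgroup φ)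
    (hs : IsSmoothOn K.fixingSubgroup φ) :
    ∃ α : Ω, ∀ g ∈ K.fixingSubgroup, g α = α + ZMod.castHom dvd_rfl Ω (φ g) := by
  obtain ⟨L, _, _, φ', -, hφ', h⟩ := exists_finite_factor hφ hs 0
  have : CharP L p := (algebraMap L Ω).charP (algebraMap L Ω).injective p
  obtain ⟨β, h1⟩ := exists_apply_eq_add _ hφ'
  refine ⟨β, fun g hg ↦ ?_⟩
  rw [← h g hg]
  have h2 := h1 _ ⟨g, hg, rfl⟩
  refine (AlgEquiv.restrictNormal_commutes g L β).symm.trans ((congrArg (Subtype.val) h2).trans ?_)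
  have h3 : (algebraMap L Ω).comp (ZMod.castHom dvd_rfl L) = ZMod.castHom dvd_rfl Ω :=
    Subsingleton.elim _ _
  rw [← h3]
  rfl

end HilbertNinety
end SolvableDegreeP

namespace SolvableDegreeP

open IntermediateField

/-! ### Eigenvectors and equivariant homomorphisms on Gal(Ω/K). -/

section Eigenvectors

theorem apply_castHom {p : ℕ} {F Ω : Type*} [Field F] [Field Ω] [Algebra F Ω] [CharP Ω p]
    (g : Gal(Ω/F)) (x : ZMod p) :
    g (ZMod.castHom dvd_rfl Ω x) = ZMod.castHom dvd_rfl Ω x :=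
  RingHom.congr_fun (Subsingleton.elim ((g : Ω →+* Ω).comp (ZMod.castHom dvd_rfl Ω))
    (ZMod.castHom dvd_rfl Ω)) x

variable {p : ℕ} [Fact p.Prime]

/-- The class of a unit in `Kˣ / (Kˣ) ^ p`. -/
def KummerQuot.mk {K : Type*} [Field K] (u : Kˣ) : KummerQuot p K :=
  Additive.ofMul (QuotientGroup.mk u)

/-- The class of an element in `K / ℘(K)`. -/
def ArtinSchreierQuot.mk {K : Type*} [Field K] [CharP K p] (u : K) : ArtinSchreierQuot p K :=
  QuotientAddGroup.mk u

theorem exists_kummer_iff {F K : Type*} [Field F] [Field K] [Algebra F K]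
    (χ : Gal(K/F) →* (ZMod p)ˣ) :
    charEigenspace (kummerRep p F K) χ ≠ ⊥ ↔ ∃ a : K, a ≠ 0 ∧ (∀ b : K, b ^ p ≠ a) ∧
      ∀ σ : Gal(K/F), ∃ b : K, σ a = a ^ (χ σ : ZMod p).val * b ^ p := by
  have hp : p ≠ 0 := (Fact.out : p.Prime).ne_zero
  have hz : ∀ u : Kˣ, KummerQuot.mk (p := p) u = 0 ↔
      ∃ b : Kˣ, b ^ p = u := fun u ↦
    (QuotientGroup.eq_one_iff (N := (powMonoidHom p : Kˣ →* Kˣ).range) u).trans MonoidHom.mem_range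
  have hs : ∀ (u : Kˣ) (n : ZMod p), n • KummerQuot.mk (p := p) u =
      KummerQuot.mk (u ^ n.val) := by
    intro u n
    conv_lhs => rw [← ZMod.natCast_zmod_val n, Nat.cast_smul_eq_nsmul]
    rfl
  have hm : ∀ (u : Kˣ), KummerQuot.mk (p := p) u ∈
      charEigenspace (kummerRep p F K) χ ↔
      ∀ σ : Gal(K/F), ∃ b : Kˣ, Units.map (σ : K →* K) u = u ^ (χ σ : ZMod p).val * b ^ p := by
    intro u
    refine forall_congr' fun σ ↦ ?_
    rw [hs]
    have e : kummerRep p F K σ (KummerQuot.mk u) =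
      KummerQuot.mk (Units.map (σ : K →* K) u) := rfl
    rw [e, eq_comm]
    refine (QuotientGroup.eq (s := (powMonoidHom p : Kˣ →* Kˣ).range)).trans
      (MonoidHom.mem_range.trans (exists_congr fun b ↦ ?_))
    rw [powMonoidHom_apply, eq_inv_mul_iff_mul_eq, eq_comm]
  rw [Submodule.ne_bot_iff]
  constructor
  · rintro ⟨⟨u⟩, hu, hne⟩
    refine ⟨u, u.ne_zero, fun b hb ↦ hne ((hz u).2 ?_), fun σ ↦ ?_⟩
    · have hb0 : b ≠ 0 := by
        rintro rfl
        rw [zero_pow hp] at hb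
        exact u.ne_zero hb.symm
      exact ⟨Units.mk0 b hb0, Units.ext hb⟩
    · obtain ⟨b, hb⟩ := (hm u).1 hu σ
      exact ⟨b, by simpa using congrArg Units.val hb⟩
  · rintro ⟨a, ha, hne, h⟩
    refine ⟨KummerQuot.mk (Units.mk0 a ha), ?_, ?_⟩
    · rw [hm]
      intro σ
      obtain ⟨b, hb⟩ := h σ
      have hb0 : b ≠ 0 := by
        rintro rfl
        rw [zero_pow hp, mul_zero] at hb
        exact ha (by simpa using hb)
      exact ⟨Units.mk0 b hb0, Units.ext (by simpa using hb)⟩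
    · rw [ne_eq, hz]
      rintro ⟨b, hb⟩
      exact hne b (by simpa using congrArg Units.val hb)

theorem exists_artinSchreier_iff {F K : Type*} [Field F] [Field K] [Algebra F K] [CharP K p]
    (χ : Gal(K/F) →* (ZMod p)ˣ) :
    charEigenspace (artinSchreierRep p F K) χ ≠ ⊥ ↔ ∃ a : K, (∀ b : K, b ^ p - b ≠ a) ∧
      ∀ σ : Gal(K/F), ∃ b : K, σ a = (χ σ : ZMod p).val * a + (b ^ p - b) := by
  have hz : ∀ u : K, ArtinSchreierQuot.mk (p := p) u = 0 ↔
      ∃ b : K, b ^ p - b = u := fun u ↦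
    (QuotientAddGroup.eq_zero_iff (N := (artinSchreier p K).range) u).trans AddMonoidHom.mem_range
  have hs : ∀ (u : K) (n : ZMod p), n • ArtinSchreierQuot.mk (p := p) u =
      ArtinSchreierQuot.mk (n.val • u) := by
    intro u n
    conv_lhs => rw [← ZMod.natCast_zmod_val n, Nat.cast_smul_eq_nsmul]
    rfl
  have hm : ∀ (u : K), ArtinSchreierQuot.mk (p := p) u ∈
      charEigenspace (artinSchreierRep p F K) χ ↔
      ∀ σ : Gal(K/F), ∃ b : K, σ u = (χ σ : ZMod p).val * u + (b ^ p - b) := by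
    intro u
    refine forall_congr' fun σ ↦ ?_
    rw [hs]
    have e : artinSchreierRep p F K σ (ArtinSchreierQuot.mk u) =
      ArtinSchreierQuot.mk (σ u) := rfl
    rw [e, eq_comm]
    refine (QuotientAddGroup.eq (s := (artinSchreier p K).range)).trans
      (AddMonoidHom.mem_range.trans (exists_congr fun b ↦ ?_))
    change b ^ p - b = _ ↔ _
    rw [eq_neg_add_iff_add_eq, eq_comm, nsmul_eq_mul]
  rw [Submodule.ne_bot_iff]
  constructor
  · rintro ⟨⟨u⟩, hu, hne⟩
    exact ⟨u, fun b hb ↦ hne ((hz u).2 ⟨b, hb⟩), (hm u).1 hu⟩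
  · rintro ⟨a, hne, h⟩
    exact ⟨ArtinSchreierQuot.mk a, (hm a).2 h, fun h0 ↦ by
      obtain ⟨b, hb⟩ := (hz a).1 h0
      exact hne b hb⟩

variable {F Ω : Type*} [Field F] [Field Ω] [Algebra F Ω]

/-- There is a nonzero continuous homomorphism from `Gal(Ω/K)` to `𝔽_p` on which `Gal(Ω/F)` acts
through `θ`. -/
def HasEquivariantHom (K : IntermediateField F Ω) (θ : Gal(Ω/F) →* (ZMod p)ˣ) : Prop :=
  ∃ φ : Gal(Ω/F) → ZMod p, IsAddOn K.fixingSubgroup φ ∧ IsSmoothOn K.fixingSubgroup φ ∧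
    IsEquivariantOn θ K.fixingSubgroup φ ∧ ∃ τ ∈ K.fixingSubgroup, φ τ ≠ 0

theorem mem_of_fixed [IsGalois F Ω] {K : IntermediateField F Ω} {x : Ω}
    (h : ∀ g ∈ K.fixingSubgroup, g x = x) : x ∈ K := by
  rw [← InfiniteGalois.fixedField_fixingSubgroup K, mem_fixedField_iff]
  exact h

theorem restrictNormalHom_coe (K : IntermediateField F Ω) [Normal F K] (g : Gal(Ω/F)) (x : K) :
    ((AlgEquiv.restrictNormalHom K g x : K) : Ω) = g x :=
  AlgEquiv.restrictNormal_commutes g K x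

theorem exists_eq_pow_mul {ζ : Ω} (hζ : IsPrimitiveRoot ζ p) {x y : Ω} (hx : x ≠ 0)
    (h : x ^ p = y ^ p) : ∃ n : ZMod p, y = ζ ^ n.val * x := by
  have h1 : (y / x) ^ p = 1 := by rw [div_pow, h, div_self]; rw [← h]; exact pow_ne_zero _ hx
  obtain ⟨i, hi, h2⟩ := hζ.eq_pow_of_pow_eq_one h1
  exact ⟨i, by rw [ZMod.val_natCast_of_lt hi, h2, div_mul_cancel₀ _ hx]⟩

/-- The difference y - x is fixed by Frobenius, hence lies in the prime field. -/
theorem exists_eq_add [CharP Ω p] {x y : Ω} (h : x ^ p - x = y ^ p - y) :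
    ∃ n : ZMod p, y = x + ZMod.castHom dvd_rfl Ω n := by
  have h1 : (y - x) ^ p = y - x := by
    rw [sub_pow_char]; linear_combination -h
  rw [← Subfield.mem_bot_iff_pow_eq_self, ← ZMod.fieldRange_castHom_eq_bot p] at h1
  obtain ⟨n, hn⟩ := h1
  exact ⟨n, by rw [hn]; ring⟩

/-! ### Characteristic different from p: Kummer theory. -/

section Kummer

variable [IsGalois F Ω] {K : IntermediateField F Ω} [Normal F K] {ζ : Ω}

/-- φ is the Kummer character g(α) = ζ^φ(g) α of a p-th root α of the eigenvector. The group acts on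
ζ through w and on the class of a through χ, whence the character wχ⁻¹. -/
theorem hasEquivariantHom_of_kummer
    (hζ : IsPrimitiveRoot ζ p) (hζK : ζ ∈ K) {w : Gal(Ω/F) →* (ZMod p)ˣ}
    (hw : ∀ g : Gal(Ω/F), g ζ = ζ ^ (w g : ZMod p).val) (χ : Gal(K/F) →* (ZMod p)ˣ)
    (hroot : ∀ a : Ω, ∃ α : Ω, α ^ p = a)
    (h : charEigenspace (kummerRep p F K) χ ≠ ⊥) :
    HasEquivariantHom K (w * (χ.comp (AlgEquiv.restrictNormalHom K))⁻¹) := by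
  classical
  obtain ⟨a, ha, hne, hσ⟩ := (exists_kummer_iff χ).1 h
  obtain ⟨α, hα⟩ := hroot a
  have hα0 : α ≠ 0 := by
    rintro rfl
    rw [zero_pow (Fact.out : p.Prime).ne_zero] at hα
    exact ha (by simpa using hα.symm)
  let e := AddChar.zmodChar p hζ.pow_eq_one
  have he : ∀ x, e x = ζ ^ x.val := AddChar.zmodChar_apply hζ.pow_eq_one
  have hinj : ∀ x y, e x = e y → x = y := fun x y hxy ↦ by
    rw [he, he] at hxy
    exact ZMod.val_injective p (hζ.pow_inj (ZMod.val_lt x) (ZMod.val_lt y) hxy)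
  have hge : ∀ (g : Gal(Ω/F)) x, g (e x) = e (w g * x) := fun g x ↦ by
    rw [he, map_pow, hw, ← he, ← AddChar.map_nsmul_eq_pow, nsmul_eq_mul, ZMod.natCast_zmod_val,
      mul_comm]
  have hKe : ∀ g ∈ K.fixingSubgroup, ∀ x, g (e x) = e x := fun g hg x ↦ by
    rw [he, map_pow, (mem_fixingSubgroup_iff _ g).1 hg ζ hζK]
  have hex : ∀ g ∈ K.fixingSubgroup, ∃ n : ZMod p, g α = e n * α := by
    intro g hg
    simp only [he]
    refine exists_eq_pow_mul hζ hα0 ?_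
    rw [← map_pow, hα, (mem_fixingSubgroup_iff _ g).1 hg _ a.2]
  let φ : Gal(Ω/F) → ZMod p := fun g ↦ if hg : g ∈ K.fixingSubgroup then (hex g hg).choose else 0
  have hφ : ∀ g ∈ K.fixingSubgroup, g α = e (φ g) * α := by
    intro g hg
    have : φ g = (hex g hg).choose := dif_pos hg
    rw [this]
    exact (hex g hg).choose_spec
  refine ⟨φ, ?_, ?_, ?_, ?_⟩
  · intro g hg k hk
    apply hinj
    apply mul_right_cancel₀ hα0
    rw [← hφ _ (mul_mem hg hk), AlgEquiv.mul_apply, hφ k hk, map_mul, hKe g hg, hφ g hg,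
      AddChar.map_add_eq_mul]
    ring
  · have : FiniteDimensional F F⟮α⟯ :=
      adjoin.finiteDimensional (Algebra.IsIntegral.isIntegral α)
    refine ⟨F⟮α⟯.fixingSubgroup, fixingSubgroup_isOpen _, fun g hg hgα ↦ ?_⟩
    apply hinj
    apply mul_right_cancel₀ hα0
    rw [← hφ g hg, AddChar.map_zero_eq_one, one_mul]
    exact (mem_fixingSubgroup_iff _ g).1 hgα α (mem_adjoin_simple_self F α)
  · intro g τ hτ
    obtain ⟨b, hb⟩ := hσ (AlgEquiv.restrictNormalHom K g⁻¹)
    set k := (χ (AlgEquiv.restrictNormalHom K g⁻¹) : ZMod p) with hk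
    have hb' : g⁻¹ (a : Ω) = (a : Ω) ^ k.val * (b : Ω) ^ p := by
      rw [← restrictNormalHom_coe, hb]; push_cast; rfl
    have hb0 : (b : Ω) ≠ 0 := by
      intro h0
      rw [h0, zero_pow (Fact.out : p.Prime).ne_zero, mul_zero] at hb'
      exact ha (by simpa using hb')
    -- Up to a root of unity, g⁻¹(α) is α^k b with b in K and k = χ(g)⁻¹, so τ multiplies it by
    -- ζ^(kφ(τ)); applying g then brings in w(g).
    obtain ⟨j, hj⟩ := exists_eq_pow_mul hζ (x := α ^ k.val * b) (y := g⁻¹ α)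
      (mul_ne_zero (pow_ne_zero _ hα0) hb0) (by
        rw [← map_pow, hα, hb', mul_pow, ← pow_mul, mul_comm k.val, pow_mul, hα])
    rw [← he] at hj
    have h1 : τ (g⁻¹ α) = e (k * φ τ) * g⁻¹ α := by
      rw [hj, map_mul, map_mul, map_pow, hKe τ hτ, hφ τ hτ, mul_pow,
        (mem_fixingSubgroup_iff _ τ).1 hτ _ b.2, ← AddChar.map_nsmul_eq_pow, nsmul_eq_mul,
        ZMod.natCast_zmod_val]
      ring
    have hn : K.fixingSubgroup.Normal := by
      rw [← restrictNormalHom_ker]; exact MonoidHom.normal_ker _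
    apply hinj
    apply mul_right_cancel₀ hα0
    rw [← hφ _ (hn.conj_mem τ hτ g), AlgEquiv.mul_apply, AlgEquiv.mul_apply, h1, map_mul, hge,
      ← AlgEquiv.mul_apply, mul_inv_cancel, AlgEquiv.one_apply]
    congr 2
    simp only [hk, map_inv, MonoidHom.mul_apply, MonoidHom.inv_apply, MonoidHom.comp_apply,
      Units.val_mul]
    ring
  · by_contra! h0
    have hαK : α ∈ K := mem_of_fixed fun g hg ↦ by
      rw [hφ g hg, h0 g hg, AddChar.map_zero_eq_one, one_mul]
    exact hne ⟨α, hαK⟩ (Subtype.ext hα)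

theorem kummer_of_hasEquivariantHom
    (hζ : IsPrimitiveRoot ζ p) (hζK : ζ ∈ K) {w : Gal(Ω/F) →* (ZMod p)ˣ}
    (hw : ∀ g : Gal(Ω/F), g ζ = ζ ^ (w g : ZMod p).val) (χ : Gal(K/F) →* (ZMod p)ˣ)
    (h : HasEquivariantHom K (w * (χ.comp (AlgEquiv.restrictNormalHom K))⁻¹)) :
    charEigenspace (kummerRep p F K) χ ≠ ⊥ := by
  obtain ⟨φ, hφ, hs, heq, τ₀, hτ₀, hne⟩ := h
  obtain ⟨α, hα0, hα⟩ := exists_kummer_generator hφ hs hζ.pow_eq_one hζK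
  let e := AddChar.zmodChar p hζ.pow_eq_one
  have he : ∀ x, e x = ζ ^ x.val := AddChar.zmodChar_apply hζ.pow_eq_one
  have hinj : ∀ x y, e x = e y → x = y := fun x y hxy ↦ by
    rw [he, he] at hxy
    exact ZMod.val_injective p (hζ.pow_inj (ZMod.val_lt x) (ZMod.val_lt y) hxy)
  have hge : ∀ (g : Gal(Ω/F)) x, g (e x) = e (w g * x) := fun g x ↦ by
    rw [he, map_pow, hw, ← he, ← AddChar.map_nsmul_eq_pow, nsmul_eq_mul, ZMod.natCast_zmod_val,
      mul_comm]
  simp only [← he] at hα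
  have hep : ∀ x, e x ^ p = 1 := fun x ↦ by
    rw [he, ← pow_mul, mul_comm, pow_mul, hζ.pow_eq_one, one_pow]
  have ha : α ^ p ∈ K := mem_of_fixed fun g hg ↦ by
    rw [map_pow, hα g hg, mul_pow, hep, one_mul]
  refine (exists_kummer_iff χ).2 ⟨⟨α ^ p, ha⟩, ?_, ?_, ?_⟩
  · intro h0
    exact pow_ne_zero p hα0 (congrArg Subtype.val h0)
  · intro b hb
    have hb' : (b : Ω) ^ p = α ^ p := congrArg Subtype.val hb
    have hb0 : (b : Ω) ≠ 0 := by
      intro h0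
      rw [h0, zero_pow (Fact.out : p.Prime).ne_zero] at hb'
      exact pow_ne_zero p hα0 hb'.symm
    obtain ⟨n, hn⟩ := exists_eq_pow_mul hζ hb0 hb'
    have hαK : α ∈ K := by rw [hn]; exact mul_mem (pow_mem hζK _) b.2
    apply hne
    apply hinj
    apply mul_right_cancel₀ hα0
    rw [← hα τ₀ hτ₀, (mem_fixingSubgroup_iff _ τ₀).1 hτ₀ α hαK, AddChar.map_zero_eq_one, one_mul]
  · intro σ
    obtain ⟨g, rfl⟩ := AlgEquiv.restrictNormalHom_surjective (F := F) (K₁ := K) Ω σ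
    set k := (χ (AlgEquiv.restrictNormalHom K g) : ZMod p) with hk
    have hn : K.fixingSubgroup.Normal := by
      rw [← restrictNormalHom_ker]; exact MonoidHom.normal_ker _
    -- Equivariance makes any τ in Gal(Ω/K) scale g(α) and α^k by the same root of unity; the p-th
    -- power of this quotient is the b of the eigenvector equation.
    have hb : g α / α ^ k.val ∈ K := mem_of_fixed fun τ hτ ↦ by
      have h1 : g⁻¹ * τ * g ∈ K.fixingSubgroup := by simpa using hn.conj_mem τ hτ g⁻¹
      have h2 := heq g _ h1
      have h3 : g * (g⁻¹ * τ * g) * g⁻¹ = τ := by group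
      rw [h3] at h2
      have h4 : (w g : ZMod p) * φ (g⁻¹ * τ * g) = k * φ τ := by
        rw [h2, hk]
        simp only [MonoidHom.mul_apply, MonoidHom.inv_apply, MonoidHom.comp_apply, Units.val_mul]
        have := Units.mul_inv (χ (AlgEquiv.restrictNormalHom K g))
        linear_combination (-(w g : ZMod p) * φ (g⁻¹ * τ * g)) * this
      have h5 : τ (g α) = e (k * φ τ) * g α := by
        have h6 : τ (g α) = g ((g⁻¹ * τ * g) α) := by
          rw [← AlgEquiv.mul_apply, ← AlgEquiv.mul_apply]
          congr 1; group
        rw [h6, hα _ h1, map_mul, hge, h4]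
      have h7 : e (k * φ τ) = e (φ τ) ^ k.val := by
        rw [← AddChar.map_nsmul_eq_pow, nsmul_eq_mul, ZMod.natCast_zmod_val]
      have h8 : e (φ τ) ^ k.val ≠ 0 := pow_ne_zero _ fun h ↦ by
        have := hep (φ τ)
        rw [h, zero_pow (Fact.out : p.Prime).ne_zero] at this
        exact zero_ne_one this
      rw [map_div₀, map_pow, h5, h7, hα τ hτ, mul_pow, mul_div_mul_left _ _ h8]
    refine ⟨⟨_, hb⟩, Subtype.ext ?_⟩
    rw [restrictNormalHom_coe]
    push_cast
    rw [map_pow, div_pow, ← pow_mul, ← pow_mul, mul_comm p, mul_div_cancel₀]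
    exact pow_ne_zero _ hα0

end Kummer

/-! ### Characteristic p: Artin–Schreier theory. -/

section ArtinSchreier

variable [IsGalois F Ω] [CharP Ω p] {K : IntermediateField F Ω} [Normal F K] [CharP K p]
  (χ : Gal(K/F) →* (ZMod p)ˣ)

theorem castHom_pow (x : ZMod p) :
    (ZMod.castHom dvd_rfl Ω x) ^ p = ZMod.castHom dvd_rfl Ω x := by
  rw [← map_pow, ZMod.pow_card]

theorem natCast_val_eq_castHom (x : ZMod p) : (x.val : Ω) = ZMod.castHom dvd_rfl Ω x := by
  rw [ZMod.castHom_apply, ZMod.natCast_val]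

/-- The additive analogue, with g(α) = α + φ(g). The values φ(g) lie in the prime field, which is
fixed by Galois, so no cyclotomic factor appears. -/
theorem hasEquivariantHom_of_artinSchreier (hroot : ∀ a : Ω, ∃ α : Ω, α ^ p - α = a)
    (h : charEigenspace (artinSchreierRep p F K) χ ≠ ⊥) :
    HasEquivariantHom K (χ.comp (AlgEquiv.restrictNormalHom K))⁻¹ := by
  classical
  obtain ⟨a, hne, hσ⟩ := (exists_artinSchreier_iff χ).1 h
  obtain ⟨α, hα⟩ := hroot a
  set ι := ZMod.castHom dvd_rfl Ω with hι
  have hex : ∀ g ∈ K.fixingSubgroup, ∃ n : ZMod p, g α = α + ι n := by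
    intro g hg
    refine exists_eq_add ?_
    rw [← map_pow, ← map_sub, hα, (mem_fixingSubgroup_iff _ g).1 hg _ a.2]
  let φ : Gal(Ω/F) → ZMod p := fun g ↦ if hg : g ∈ K.fixingSubgroup then (hex g hg).choose else 0
  have hφ : ∀ g ∈ K.fixingSubgroup, g α = α + ι (φ g) := by
    intro g hg
    have : φ g = (hex g hg).choose := dif_pos hg
    rw [this]
    exact (hex g hg).choose_spec
  have hfix : ∀ (g : Gal(Ω/F)) x, g (ι x) = ι x := apply_castHom
  refine ⟨φ, ?_, ?_, ?_, ?_⟩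
  · intro g hg k hk
    apply ι.injective
    apply add_left_cancel (a := α)
    rw [← hφ _ (mul_mem hg hk), AlgEquiv.mul_apply, hφ k hk, map_add, hfix, hφ g hg, map_add]
    ring
  · have : FiniteDimensional F F⟮α⟯ :=
      adjoin.finiteDimensional (Algebra.IsIntegral.isIntegral α)
    refine ⟨F⟮α⟯.fixingSubgroup, fixingSubgroup_isOpen _, fun g hg hgα ↦ ?_⟩
    apply ι.injective
    apply add_left_cancel (a := α)
    rw [← hφ g hg, map_zero, add_zero]
    exact (mem_fixingSubgroup_iff _ g).1 hgα α (mem_adjoin_simple_self F α)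
  · intro g τ hτ
    obtain ⟨b, hb⟩ := hσ (AlgEquiv.restrictNormalHom K g⁻¹)
    set k := (χ (AlgEquiv.restrictNormalHom K g⁻¹) : ZMod p) with hk
    have hb' : g⁻¹ (a : Ω) = ι k * (a : Ω) + ((b : Ω) ^ p - b) := by
      rw [← restrictNormalHom_coe, hb, hι, ← natCast_val_eq_castHom]; push_cast; rfl
    obtain ⟨j, hj⟩ := exists_eq_add (x := ι k * α + b) (y := g⁻¹ α) (by
        rw [← map_pow, ← map_sub, hα, hb', add_pow_char, mul_pow, hι, castHom_pow, ← hι, ← hα]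
        ring)
    have h1 : τ (g⁻¹ α) = g⁻¹ α + ι (k * φ τ) := by
      rw [hj, map_add, map_add, map_mul, hfix, hfix, hφ τ hτ,
        (mem_fixingSubgroup_iff _ τ).1 hτ _ b.2, map_mul]
      ring
    have hn : K.fixingSubgroup.Normal := by
      rw [← restrictNormalHom_ker]; exact MonoidHom.normal_ker _
    apply ι.injective
    apply add_left_cancel (a := α)
    rw [← hφ _ (hn.conj_mem τ hτ g), AlgEquiv.mul_apply, AlgEquiv.mul_apply, h1, map_add, hfix,
      ← AlgEquiv.mul_apply, mul_inv_cancel, AlgEquiv.one_apply]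
    congr 3
    simp only [hk, map_inv, MonoidHom.inv_apply, MonoidHom.comp_apply]
  · by_contra! h0
    have hαK : α ∈ K := mem_of_fixed fun g hg ↦ by
      rw [hφ g hg, h0 g hg, map_zero, add_zero]
    exact hne ⟨α, hαK⟩ (Subtype.ext hα)

theorem artinSchreier_of_hasEquivariantHom
    (h : HasEquivariantHom K (χ.comp (AlgEquiv.restrictNormalHom K))⁻¹) :
    charEigenspace (artinSchreierRep p F K) χ ≠ ⊥ := by
  obtain ⟨φ, hφ, hs, heq, τ₀, hτ₀, hne⟩ := h
  obtain ⟨α, hα⟩ := exists_artinSchreier_generator hφ hs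
  set ι := ZMod.castHom dvd_rfl Ω with hι
  have hfix : ∀ (g : Gal(Ω/F)) x, g (ι x) = ι x := apply_castHom
  have hip : ∀ x, ι x ^ p = ι x := castHom_pow
  have ha : α ^ p - α ∈ K := mem_of_fixed fun g hg ↦ by
    rw [map_sub, map_pow, hα g hg, add_pow_char, hip]; ring
  refine (exists_artinSchreier_iff χ).2 ⟨⟨α ^ p - α, ha⟩, ?_, ?_⟩
  · intro b hb
    obtain ⟨n, hn⟩ := exists_eq_add (x := (b : Ω)) (y := α) (congrArg Subtype.val hb)
    apply hne
    apply ι.injective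
    apply add_left_cancel (a := α)
    rw [← hα τ₀ hτ₀, hn, map_add, (mem_fixingSubgroup_iff _ τ₀).1 hτ₀ _ b.2, ← hι, hfix, map_zero,
      add_zero]
  · intro σ
    obtain ⟨g, rfl⟩ := AlgEquiv.restrictNormalHom_surjective (F := F) (K₁ := K) Ω σ
    set k := (χ (AlgEquiv.restrictNormalHom K g) : ZMod p) with hk
    have hn : K.fixingSubgroup.Normal := by
      rw [← restrictNormalHom_ker]; exact MonoidHom.normal_ker _
    have hb : g α - ι k * α ∈ K := mem_of_fixed fun τ hτ ↦ by
      have h1 : g⁻¹ * τ * g ∈ K.fixingSubgroup := by simpa using hn.conj_mem τ hτ g⁻¹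
      have h2 := heq g _ h1
      have h3 : g * (g⁻¹ * τ * g) * g⁻¹ = τ := by group
      rw [h3] at h2
      have h4 : φ (g⁻¹ * τ * g) = k * φ τ := by
        rw [h2, hk]
        simp only [MonoidHom.inv_apply, MonoidHom.comp_apply]
        rw [← mul_assoc, Units.mul_inv, one_mul]
      have h5 : τ (g α) = g α + ι (k * φ τ) := by
        have h6 : τ (g α) = g ((g⁻¹ * τ * g) α) := by
          rw [← AlgEquiv.mul_apply, ← AlgEquiv.mul_apply]
          congr 1; group
        rw [h6, hα _ h1, map_add, hfix, h4]
      rw [map_sub, map_mul, h5, hfix, hα τ hτ, map_mul]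
      ring
    refine ⟨⟨_, hb⟩, Subtype.ext ?_⟩
    rw [restrictNormalHom_coe]
    push_cast
    rw [natCast_val_eq_castHom, ← hι, sub_pow_char, mul_pow, hip, map_sub, map_pow]
    ring

end ArtinSchreier

end Eigenvectors
end SolvableDegreeP

namespace SolvableDegreeP

open IntermediateField

/-! ### Comparison of K', C and the abelian extensions of K'. -/

section Main

variable {p : ℕ} [Fact p.Prime] {F Ω : Type*} [Field F] [Field Ω] [Algebra F Ω]

theorem omega_apply_eq [IsSepClosure F Ω] (h : (p : F) ≠ 0) {ζ : fieldK p F Ω} (hζ : ζ ^ p = 1)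
    (σ : Gal((fieldK p F Ω)/F)) : σ ζ = ζ ^ (omega p F Ω σ : ZMod p).val := by
  have hu : (Units.ofPowEqOne ζ p hζ (Fact.out : p.Prime).ne_zero) ∈
      rootsOfUnity p (fieldK p F Ω) := by
    rw [mem_rootsOfUnity]
    exact Units.ext (by simp)
  have := modularCyclotomicCharacter.spec (fieldK p F Ω) (card_rootsOfUnity_fieldK p F Ω h)
    (MulSemiringAction.toRingAut Gal((fieldK p F Ω)/F) (fieldK p F Ω) σ) hu
  rw [omega, dif_neg h]
  simpa using this

theorem hasEigenvector_iff [IsSepClosure F Ω] (χ : Gal((fieldK p F Ω)/F) →* (ZMod p)ˣ) :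
    HasEigenvector p F Ω χ ↔ HasEquivariantHom (fieldK p F Ω) (twist p F Ω χ) := by
  have hsep : IsSepClosed Ω := IsSepClosure.sep_closed F
  have hgal : IsGalois F Ω := IsSepClosure.isGalois
  by_cases h : (p : F) = 0
  · have hF : CharP F p := (CharP.charP_iff_prime_eq_zero Fact.out).2 h
    have hΩ : CharP Ω p := charP_of_injective_algebraMap' F p
    have hK : CharP (fieldK p F Ω) p := charP_of_injective_algebraMap' F p
    have e : twist p F Ω χ = (χ.comp (AlgEquiv.restrictNormalHom (fieldK p F Ω)))⁻¹ := by
      have h1 : omega p F Ω = 1 := dif_pos h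
      rw [twist, h1]
      ext g
      simp only [MonoidHom.comp_apply, MonoidHom.mul_apply, MonoidHom.one_apply, one_mul,
        MonoidHom.inv_apply]
    rw [e]
    constructor
    · rintro (⟨h1, -⟩ | ⟨_, h1⟩)
      · exact absurd hF h1
      · refine hasEquivariantHom_of_artinSchreier χ (fun a ↦ ?_) h1
        -- X^p - X - a is separable, so it has a root in Ω.
        obtain ⟨x, hx⟩ := IsSepClosed.exists_root_C_mul_X_pow_add_C_mul_X_add_C (1 : Ω) (-1) (-a)
          (CharP.cast_eq_zero Ω p) (Fact.out : p.Prime).two_le (by simp)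
        exact ⟨x, by linear_combination hx⟩
    · exact fun h1 ↦ Or.inr ⟨hF, artinSchreier_of_hasEquivariantHom χ h1⟩
  · have hF : ¬ CharP F p := fun hF ↦ h (CharP.cast_eq_zero F p)
    have hΩ : NeZero (p : Ω) := ⟨by
      rw [← map_natCast (algebraMap F Ω)]
      exact (map_ne_zero _).2 h⟩
    have hcard := card_rootsOfUnity_fieldK p F Ω h
    obtain ⟨ζ, hζK, hζ⟩ : ∃ ζ ∈ fieldK p F Ω, IsPrimitiveRoot ζ p := by
      have : IsCyclic (rootsOfUnity p (fieldK p F Ω)) := inferInstance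
      obtain ⟨u, hu⟩ := this.exists_generator
      have h1 := orderOf_eq_card_of_forall_mem_zpowers hu
      rw [hcard] at h1
      refine ⟨_, ((u : (fieldK p F Ω)ˣ) : fieldK p F Ω).2, ?_⟩
      have h2 := IsPrimitiveRoot.orderOf u
      rw [h1] at h2
      have h3 : IsPrimitiveRoot (u : (fieldK p F Ω)ˣ) p :=
        IsPrimitiveRoot.coe_submonoidClass_iff.2 h2
      exact (IsPrimitiveRoot.coe_units_iff.2 h3).map_of_injective
        (algebraMap (fieldK p F Ω) Ω).injective
    have e : twist p F Ω χ = (omega p F Ω).comp (AlgEquiv.restrictNormalHom (fieldK p F Ω)) *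
        (χ.comp (AlgEquiv.restrictNormalHom (fieldK p F Ω)))⁻¹ := rfl
    rw [e]
    have hw : ∀ g : Gal(Ω/F), g ζ = ζ ^ (((omega p F Ω).comp
        (AlgEquiv.restrictNormalHom (fieldK p F Ω))) g : ZMod p).val := by
      intro g
      have h1 := omega_apply_eq h (ζ := ⟨ζ, hζK⟩) (Subtype.ext hζ.pow_eq_one)
        (AlgEquiv.restrictNormalHom (fieldK p F Ω) g)
      exact (restrictNormalHom_coe _ g ⟨ζ, hζK⟩).symm.trans (congrArg Subtype.val h1)
    constructor
    · rintro (⟨-, h1⟩ | ⟨h1, -⟩)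
      · exact hasEquivariantHom_of_kummer hζ hζK hw χ
          (fun a ↦ IsSepClosed.exists_pow_nat_eq a p) h1
      · exact absurd h1 hF
    · exact fun h1 ↦ Or.inl ⟨hF, kummer_of_hasEquivariantHom hζ hζK hw χ h1⟩

/-- θ factors through Gal(K/F), and θ = ωχ⁻¹ can be solved for χ. -/
theorem exists_eq_twist [IsSepClosure F Ω] {θ : Gal(Ω/F) →* (ZMod p)ˣ}
    (hθ : IsOpen (θ.ker : Set Gal(Ω/F))) : ∃ χ, twist p F Ω χ = θ := by
  have hgal : IsGalois F Ω := IsSepClosure.isGalois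
  have hker : (AlgEquiv.restrictNormalHom (F := F) (K₁ := Ω) (fieldK p F Ω)).ker ≤ θ.ker := by
    rw [restrictNormalHom_ker]
    exact fixingSubgroup_fieldK_le_ker hθ
  have hsurj := AlgEquiv.restrictNormalHom_surjective (F := F) (K₁ := fieldK p F Ω) Ω
  let f : Gal((fieldK p F Ω)/F) →* (ZMod p)ˣ :=
    (AlgEquiv.restrictNormalHom (fieldK p F Ω)).liftOfSurjective hsurj ⟨θ, hker⟩
  have hf : ∀ g, f (AlgEquiv.restrictNormalHom (fieldK p F Ω) g) = θ g := fun g ↦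
    MonoidHom.liftOfRightInverse_comp_apply ..
  refine ⟨omega p F Ω * f⁻¹, MonoidHom.ext fun g ↦ ?_⟩
  simp [twist, hf]

theorem IsAffine.hasEquivariantHom [IsSepClosure F Ω] {θ : Gal(Ω/F) →* (ZMod p)ˣ}
    {c : Gal(Ω/F) → ZMod p} (h : IsAffine θ c) : HasEquivariantHom (fieldK p F Ω) θ := by
  have hgal : IsGalois F Ω := IsSepClosure.isGalois
  have hle := fixingSubgroup_fieldK_le_ker h.isOpen_ker
  obtain ⟨U, hU, h1⟩ := h.2.1
  refine ⟨c, h.1.isAddOn hle, ⟨U, hU, fun g _ hg ↦ (h1 g hg).2⟩, h.1.isEquivariantOn hle, ?_⟩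
  obtain ⟨τ, hτ, hne⟩ := h.2.2
  -- τ itself need not fix K, but this power does, and c takes there the value (p - 1) c(τ) = -c(τ).
  refine ⟨τ ^ (p - 1), pow_mem_fixingSubgroup_fieldK p τ, ?_⟩
  rw [(h.1.isAddOn (N := θ.ker) fun g hg ↦ hg).map_pow hτ, Nat.cast_sub (Fact.out : p.Prime).one_le]
  simpa using hne

/-- The characters ωχ⁻¹ with V(χ) ≠ 0 are exactly the θ occurring in affine pairs: restrict c to
Gal(Ω/K) one way, extend φ to Γ the other. -/
theorem mem_fixingSubgroup_fieldK' [IsSepClosure F Ω] (g : Gal(Ω/F)) :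
    g ∈ (fieldK' p F Ω).fixingSubgroup ↔
      ∀ (θ : Gal(Ω/F) →* (ZMod p)ˣ) (c : Gal(Ω/F) → ZMod p), IsAffine θ c → θ g = 1 := by
  have hgal : IsGalois F Ω := IsSepClosure.isGalois
  simp only [fieldK', fixingSubgroup_iSup, Subgroup.mem_iInf, fieldChi_eq, hasEigenvector_iff]
  constructor
  · intro h θ c hA
    obtain ⟨χ, rfl⟩ := exists_eq_twist hA.isOpen_ker
    have h1 := h χ hA.hasEquivariantHom
    rwa [fixingSubgroup_fixedField_of_isClosed (Subgroup.isClosed_of_isOpen _ hA.isOpen_ker)] at h1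
  · rintro h χ ⟨φ, hφ, hs, heq, τ, hτ, hne⟩
    obtain ⟨c, hc, -⟩ := exists_isAffine_of_isEquivariantOn (normal_fixingSubgroup_fieldK p F Ω)
      (pow_mem_fixingSubgroup_fieldK p) (fun g hg ↦ by
        rw [← restrictNormalHom_ker, MonoidHom.mem_ker] at hg
        rw [twist, MonoidHom.comp_apply, hg, map_one]) hφ hs heq hτ hne
    rw [fixingSubgroup_fixedField_of_isClosed (Subgroup.isClosed_of_isOpen _ hc.isOpen_ker)]
    exact h _ c hc

theorem isAbelianExtOfExponentDvd_iff {k : Type*} [Field k] [Algebra k Ω] [IsGalois k Ω] (n : ℕ)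
    (N : IntermediateField k Ω) : IsAbelianExtOfExponentDvd n k N ↔
      (∀ g h : Gal(Ω/k), g * h * g⁻¹ * h⁻¹ ∈ N.fixingSubgroup) ∧
        ∀ g : Gal(Ω/k), g ^ n ∈ N.fixingSubgroup := by
  constructor
  · rintro ⟨h1, h2⟩
    simp only [← restrictNormalHom_ker, MonoidHom.mem_ker, map_mul, map_inv, map_pow]
    refine ⟨fun g h ↦ ?_, fun g ↦ Monoid.exponent_dvd_iff_forall_pow_eq_one.1 h2 _⟩
    rw [h1.is_comm.comm (AlgEquiv.restrictNormalHom N g)]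
    group
  · rintro ⟨h1, h2⟩
    -- A subgroup containing all commutators is normal, so N is automatically Galois.
    have hn : N.fixingSubgroup.Normal := ⟨fun x hx g ↦ by
      simpa using mul_mem (h1 g x) hx⟩
    have hgal : IsGalois k N := (InfiniteGalois.normal_iff_isGalois N).1 hn
    simp only [← restrictNormalHom_ker, MonoidHom.mem_ker, map_mul, map_inv, map_pow] at h1 h2
    have hsurj := AlgEquiv.restrictNormalHom_surjective (F := k) (K₁ := N) Ω
    refine ⟨{ toIsGalois := hgal, is_comm := ⟨fun a b ↦ ?_⟩ }, ?_⟩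
    · obtain ⟨g, rfl⟩ := hsurj a
      obtain ⟨h, rfl⟩ := hsurj b
      have := h1 g h
      rwa [mul_inv_eq_one, mul_inv_eq_iff_eq_mul] at this
    · refine Monoid.exponent_dvd_of_forall_pow_eq_one fun a ↦ ?_
      obtain ⟨g, rfl⟩ := hsurj a
      exact h2 g

theorem exists_dual_apply_ne_zero {k V : Type*} [Field k] [AddCommGroup V] [Module k V] {v : V}
    (hv : v ≠ 0) : ∃ f : V →ₗ[k] k, f v ≠ 0 :=
  Module.Projective.exists_dual_ne_zero k hv

theorem exists_addMonoidHom_ne_zero {V : Type*} [AddCommGroup V] (hexp : ∀ v : V, p • v = 0) {v : V}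
    (hv : v ≠ 0) : ∃ f : V →+ ZMod p, f v ≠ 0 := by
  let _ : Module (ZMod p) V := AddCommGroup.zmodModule hexp
  obtain ⟨f, hf⟩ := exists_dual_apply_ne_zero (k := ZMod p) hv
  exact ⟨f.toAddMonoidHom, hf⟩

/-- A nontrivial element of an abelian group of exponent `p` is detected by a homomorphism to
`𝔽_p`. -/
theorem exists_hom_ne_zero {A : Type*} [CommGroup A] (hexp : ∀ a : A, a ^ p = 1) {a : A}
    (ha : a ≠ 1) : ∃ f : A → ZMod p, (∀ x y, f (x * y) = f x + f y) ∧ f a ≠ 0 := by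
  obtain ⟨f, hf⟩ := exists_addMonoidHom_ne_zero (V := Additive A) (v := .ofMul a)
    (fun x ↦ hexp x.toMul) ha
  exact ⟨fun x ↦ f (.ofMul x), fun x y ↦ f.map_add _ _, hf⟩

/-- Some homomorphism from the Galois group of k(m)/k to 𝔽_p is nonzero at g. Pulled back to
Gal(Ω/k) it vanishes on the elements fixing m, hence is continuous. By `hT`, Γ modulo Gal(Ω/k)
embeds in a product of copies of 𝔽_pˣ, so it is abelian of exponent dividing p - 1. -/
theorem exists_isAffine_of_not_fixed [IsGalois F Ω] {k : IntermediateField F Ω}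
    (hT : ∀ g, g ∈ k.fixingSubgroup ↔ ∀ (θ : Gal(Ω/F) →* (ZMod p)ˣ) (c : Gal(Ω/F) → ZMod p),
      IsAffine θ c → θ g = 1)
    {M : IntermediateField k Ω} (hM : IsAbelianExtOfExponentDvd p k M)
    {m : Ω} (hm : m ∈ M) {g : Gal(Ω/F)} (hg : g ∈ k.fixingSubgroup) (hgm : g m ≠ m) :
    ∃ θ c, IsAffine (p := p) θ c ∧ c g ≠ 0 := by
  classical
  set L := adjoin k {m}
  have hLM : L ≤ M := adjoin_simple_le_iff.2 hm
  have hL : IsAbelianExtOfExponentDvd p k L := by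
    rw [isAbelianExtOfExponentDvd_iff] at hM ⊢
    exact ⟨fun a b ↦ fixingSubgroup_le hLM (hM.1 a b), fun a ↦ fixingSubgroup_le hLM (hM.2 a)⟩
  have hLgal : IsGalois k L := hL.1.toIsGalois
  let r : k.fixingSubgroup →* Gal(L/k) :=
    (AlgEquiv.restrictNormalHom L).comp (fixingSubgroupEquiv k).toMonoidHom
  have hr : ∀ (h : Gal(Ω/F)) (hh : h ∈ k.fixingSubgroup), r ⟨h, hh⟩ = 1 ↔ h m = m := by
    intro h hh
    have h1 : r ⟨h, hh⟩ = 1 ↔ fixingSubgroupEquiv k ⟨h, hh⟩ ∈ L.fixingSubgroup := by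
      rw [← restrictNormalHom_ker L]; rfl
    rw [h1]
    constructor
    · exact fun h2 ↦ (mem_fixingSubgroup_iff _ _).1 h2 m (mem_adjoin_simple_self k m)
    · intro h2
      rw [← Subgroup.zpowers_le, ← le_iff_le, adjoin_simple_le_iff, mem_fixedField_iff]
      intro f hf
      have h3 : Subgroup.zpowers (fixingSubgroupEquiv k ⟨h, hh⟩) ≤
          MulAction.stabilizer Gal(Ω/k) m := Subgroup.zpowers_le.2 h2
      exact h3 hf
  let _ : CommGroup Gal(L/k) :=
    { (inferInstance : Group Gal(L/k)) with mul_comm := hL.1.is_comm.comm }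
  obtain ⟨f, hf, hne⟩ := exists_hom_ne_zero (a := r ⟨g, hg⟩)
    (Monoid.exponent_dvd_iff_forall_pow_eq_one.1 hL.2) (fun h ↦ hgm ((hr g hg).1 h))
  have hf1 : f 1 = 0 := by simpa using hf 1 1
  let φ : Gal(Ω/F) → ZMod p := fun h ↦ if hh : h ∈ k.fixingSubgroup then f (r ⟨h, hh⟩) else 0
  have hφ : ∀ h (hh : h ∈ k.fixingSubgroup), φ h = f (r ⟨h, hh⟩) := fun h hh ↦ dif_pos hh
  have hn : k.fixingSubgroup.Normal := ⟨fun x hx y ↦ by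
    rw [hT] at hx ⊢
    intro θ c hA
    rw [map_mul, map_mul, hx θ c hA, mul_one, ← map_mul, mul_inv_cancel, map_one]⟩
  have hfin : FiniteDimensional F F⟮m⟯ := adjoin.finiteDimensional (Algebra.IsIntegral.isIntegral m)
  refine exists_isAffine_apply_ne_zero (P := k.fixingSubgroup) (φ := φ) hn ?_ ?_ ?_
    ⟨F⟮m⟯.fixingSubgroup, fixingSubgroup_isOpen _, ?_⟩ hg (by rwa [hφ g hg])
  · intro x
    rw [hT]
    intro θ c _
    rw [map_pow, ZMod.units_pow_card_sub_one_eq_one]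
  · intro x y
    rw [hT]
    intro θ c _
    simp only [map_mul, map_inv]
    rw [mul_comm (θ x)]; group
  · intro x hx y hy
    rw [hφ x hx, hφ y hy, hφ _ (mul_mem hx hy), ← hf, ← map_mul]
    rfl
  · intro x hx hxm
    rw [hφ x hx, (hr x hx).2 ((mem_fixingSubgroup_iff _ x).1 hxm m (mem_adjoin_simple_self F m)),
      hf1]

end Main
end SolvableDegreeP

theorem lemma20 (p : ℕ) [Fact p.Prime] (F Ω : Type*) [Field F] [Field Ω] [Algebra F Ω]
    [IsSepClosure F Ω] :
    ∃ M' : IntermediateField (SolvableDegreeP.fieldK' p F Ω) Ω,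
      IsGreatest {M : IntermediateField (SolvableDegreeP.fieldK' p F Ω) Ω |
        SolvableDegreeP.IsAbelianExtOfExponentDvd p (SolvableDegreeP.fieldK' p F Ω) M} M' ∧
      SolvableDegreeP.solvableCompositum p F Ω = M'.restrictScalars F := by
  open SolvableDegreeP IntermediateField in
  have hgal : IsGalois F Ω := IsSepClosure.isGalois
  have hK' := mem_fixingSubgroup_fieldK' (p := p) (F := F) (Ω := Ω)
  have hC := fixingSubgroup_solvableCompositum (p := p) (F := F) (Ω := Ω)
  have hle : fieldK' p F Ω ≤ solvableCompositum p F Ω := fun x hx ↦ mem_of_fixed fun g hg ↦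
    (IntermediateField.mem_fixingSubgroup_iff _ g).1
      ((hK' g).2 fun θ c hA ↦ ((hC g).1 hg θ c hA).1) x hx
  have hres : ∀ g : Gal(Ω/fieldK' p F Ω),
      g ∈ (extendScalars hle).fixingSubgroup ↔
        ∀ (θ : Gal(Ω/F) →* (ZMod p)ˣ) (c : Gal(Ω/F) → ZMod p), IsAffine θ c →
          c (g.restrictScalars F) = 0 := by
    intro g
    have h1 : ∀ (θ : Gal(Ω/F) →* (ZMod p)ˣ) (c : Gal(Ω/F) → ZMod p), IsAffine θ c →
        θ (g.restrictScalars F) = 1 :=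
      (hK' _).1 <| (IntermediateField.mem_fixingSubgroup_iff _ _).2 fun x hx ↦ g.commutes ⟨x, hx⟩
    have h2 : g ∈ (extendScalars hle).fixingSubgroup ↔
        g.restrictScalars F ∈ (solvableCompositum p F Ω).fixingSubgroup := by
      rw [IntermediateField.mem_fixingSubgroup_iff, IntermediateField.mem_fixingSubgroup_iff]
      rfl
    rw [h2, hC]
    exact ⟨fun h θ c hA ↦ (h θ c hA).2, fun h θ c hA ↦ ⟨h1 θ c hA, h θ c hA⟩⟩
  have hadd : ∀ (θ : Gal(Ω/F) →* (ZMod p)ˣ) (c : Gal(Ω/F) → ZMod p), IsAffine θ c →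
      IsAddOn (fieldK' p F Ω).fixingSubgroup c := fun θ c hA ↦
    hA.1.isAddOn fun g hg ↦ (hK' g).1 hg θ c hA
  have hmem : ∀ g : Gal(Ω/fieldK' p F Ω),
      g.restrictScalars F ∈ (fieldK' p F Ω).fixingSubgroup := fun g ↦
    (IntermediateField.mem_fixingSubgroup_iff _ _).2 fun x hx ↦ g.commutes ⟨x, hx⟩
  refine ⟨extendScalars hle, ⟨?_, ?_⟩, (extendScalars_restrictScalars hle).symm⟩
  · refine (isAbelianExtOfExponentDvd_iff p _).2 ⟨fun g h ↦ (hres _).2 fun θ c hA ↦ ?_,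
      fun g ↦ (hres _).2 fun θ c hA ↦ ?_⟩
    · have e : (g * h * g⁻¹ * h⁻¹).restrictScalars F = g.restrictScalars F * h.restrictScalars F *
        (g.restrictScalars F)⁻¹ * (h.restrictScalars F)⁻¹ := rfl
      have ha := hadd θ c hA
      rw [e, ha _ (mul_mem (mul_mem (hmem g) (hmem h)) (inv_mem (hmem g))) _ (inv_mem (hmem h)),
        ha.map_conj (hmem g) (hmem h), ha.map_inv (hmem h), add_neg_cancel]
    · have e : (g ^ p).restrictScalars F = (g.restrictScalars F) ^ p :=
        map_pow (AlgEquiv.restrictScalarsHom F) g p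
      rw [e, (hadd θ c hA).map_pow (hmem g), CharP.cast_eq_zero, zero_mul]
  -- An element g fixing C but moving m would fix K' and have c(g) ≠ 0 for some affine pair,
  -- contrary to the description of Gal(Ω/C).
  · intro M hM m hm
    rw [mem_extendScalars]
    refine mem_of_fixed fun g hg ↦ ?_
    by_contra hgm
    obtain ⟨θ, c, hA, hne⟩ := exists_isAffine_of_not_fixed hK' hM hm
      ((hK' g).2 fun θ c hA ↦ ((hC g).1 hg θ c hA).1) hgm
    exact hne ((hC g).1 hg θ c hA).2
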